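/- Let $\mathbb K$ be a field of characteristic $0$. Let $\mathbf{Sym}$ be the Hopf algebra of noncommutative symmetric functions, freely generated by $S_1,S_2,\dots$ with $\Delta S_n=\sum_{i+j=n}S_i\otimes S_j$ ($S_0=1$), and let $QSym$ be the algebra of quasi-symmetric functions with basis $M_I=\sum_{n_1<\cdots<n_r}x_{n_1}^{i_1}\cdots x_{n_r}^{i_r}$, in duality with $\mathbf{Sym}$ by $\langle M_I,S^J\rangle=\delta_{IJ}$, where $S^J=S_{j_1}\cdots S_{j_r}$. Let $\mathbf{WSym}$ be the Hopf algebra of symmetric functions in noncommuting variables over an infinite alphabet $A$, with linear basis $\mathbf M_\pi=\sum a_1\cdots a_n$ for $\pi$ a set partition of $[n]$ (sum over the words with $a_i=a_j$ if and only if $i,j$ are in the same block of $\pi$), with the product of noncommutative series and the coproduct $f\mapsto f(A'\sqcup A'')$ given by the disjoint union of mutually commuting alphabets. For a set partition $\pi$ of $[n]$ with block maxima $m_1<\cdots<m_k=n$, let $K(\pi)$ be the composition of $n$ whose $s$-th part is the size of the block with maximum $m_s$, and let $C(\pi)=(m_1,m_2-m_1,\dots,m_k-m_{k-1})$. (For $n=0$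 both are the empty composition.) The quotient of $\mathbf{WSym}$ by the two-sided ideal generated by the differences $\mathbf M_\pi-\mathbf M_{\pi'}$ with $K(\pi)=K(\pi')$ is isomorphic to $\mathbf{Sym}$ as a graded Hopf algebra. Fix any such isomorphism, and let $V_I\in\mathbf{Sym}$ be the image of the class of the $\mathbf M_\pi$ with $K(\pi)=I$; the $V_I$ form a basis of $\mathbf{Sym}$. For compositions $I,J$ of $n$, let $c_{IJ}=\#\{\pi : K(\pi)=I,\ C(\pi)=J\}$ (which is $0$ unless $I$ and $J$ have the same length), and let $X_J=\sum_{I\vDash n}c_{IJ}V_I$. Then $(X_J)$ is a basis of $\mathbf{Sym}$, and it has a dual basis $(Z_I)$ in $QSym$, $\langle Z_I,X_J\rangle=\delta_{IJ}$, which satisfies the binary shuffle product rule: for all compositions $I$, $J$, $$Z_I Z_J=\sum_K\langle \epsilon_K\,|\,\epsilon_I \sqcup\!\sqcup \epsilon_J\rangle\, Z_K ,$$ where $\epsilon_I=0^{i_1-1}1\,0^{i_2-1}1\cdots0^{i_r-1}1$, $\sqcup\!\sqcup$ denotes the shuffle product of words, $\langle w\,|\,y\rangle$ is the coefficient of $w$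 in $y$, and $K$ runs over the compositions of $|I|+|J|$ (the coefficient is $0$ for the other ones). -/

import Mathlib

open scoped TensorProduct

noncomputable section

namespace BinaryShuffle

/-! ### Words, shuffles and the binary encoding of compositions -/

/-- All shuffles of two words, listed with multiplicity. -/
def shuffle {α : Type*} : List α → List α → List (List α)
  | [], v => [v]
  | a :: u, [] => [a :: u]
  | a :: u, b :: v =>
      (shuffle u (b :: v)).map (List.cons a) ++ (shuffle (a :: u) v).map (List.cons b)
  termination_by u v => u.length + v.length

/-- The binary word `0^{i₁-1} 1 0^{i₂-1} 1 ⋯ 0^{i_r-1} 1`, with `false` for `0` and `true` for `1`. -/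
def binWord (I : List ℕ) : List Bool :=
  I.flatMap fun i => List.replicate (i - 1) false ++ [true]

/-- The coefficient of the word `w` in the shuffle of `u` and `v`. -/
def shuffleCoeff (w u v : List Bool) : ℕ := (shuffle u v).count w

/-! ### Set partitions of `Fin n` and their two compositions -/

/-- A set partition of an `n`-element totally ordered set. -/
abbrev SetPartition (n : ℕ) := Finpartition (Finset.univ : Finset (Fin n))

/-- The set of maximal elements of the blocks. -/
def maxima {n : ℕ} (π : SetPartition n) : Finset (Fin n) :=
  Finset.univ.filter fun i => ∀ j ∈ π.part i, j ≤ i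

/-- `K(π)`: the block sizes, the blocks being ordered by increasing maxima. -/
def sizeComp {n : ℕ} (π : SetPartition n) : List ℕ :=
  ((maxima π).sort (· ≤ ·)).map fun i => (π.part i).card

/-- The block maxima in increasing order, as elements of `{1, …, n}`. -/
def maximaList {n : ℕ} (π : SetPartition n) : List ℕ :=
  ((maxima π).sort (· ≤ ·)).map fun i => (i : ℕ) + 1

/-- `C(π)`: the composition `(m₁, m₂ - m₁, …, m_k - m_{k-1})`, where `m₁ < ⋯ < m_k` are the
block maxima; that is, the composition of `n` whose partial sums are the block maxima. -/
def maxComp {n : ℕ} (π : SetPartition n) : List ℕ :=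
  List.zipWith (fun x y => x - y) (maximaList π) (0 :: maximaList π)

/-- `c_{IJ}`: the number of set partitions `π` with `K(π) = I` and `C(π) = J`. -/
def c {n : ℕ} (I J : Composition n) : ℕ :=
  (Finset.univ.filter fun π : SetPartition n =>
    sizeComp π = I.blocks ∧ maxComp π = J.blocks).card

/-! ### Noncommutative formal power series over the alphabet `ℕ` -/

/-- Noncommutative formal power series over the infinite alphabet `ℕ`, as functions on words. -/
def NCSeries (K : Type*) := List ℕ → K

namespace NCSeries

set_option linter.unusedSectionVars false

variable {K : Type*} [Field K]

instance : AddCommGroup (NCSeries K) := inferInstanceAs (AddCommGroup (List ℕ → K))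
instance : Module K (NCSeries K) := inferInstanceAs (Module K (List ℕ → K))

@[ext] theorem ext {f g : NCSeries K} (h : ∀ w : List ℕ, f w = g w) : f = g := funext h

/-- The concatenation (Cauchy) product. -/
instance : Mul (NCSeries K) :=
  ⟨fun f g w => ∑ i ∈ Finset.range (w.length + 1), f (w.take i) * g (w.drop i)⟩

instance : One (NCSeries K) := ⟨fun w => if w = [] then 1 else 0⟩

theorem mul_apply (f g : NCSeries K) (w : List ℕ) :
    (f * g) w = ∑ i ∈ Finset.range (w.length + 1), f (w.take i) * g (w.drop i) := rfl

theorem one_apply (w : List ℕ) : (1 : NCSeries K) w = if w = [] then 1 else 0 := rfl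

@[simp] theorem add_apply (f g : NCSeries K) (w : List ℕ) : (f + g) w = f w + g w := rfl
@[simp] theorem zero_apply (w : List ℕ) : (0 : NCSeries K) w = 0 := rfl
@[simp] theorem smul_apply (r : K) (f : NCSeries K) (w : List ℕ) : (r • f) w = r * f w := rfl

theorem mul_nil (f g : NCSeries K) : (f * g) [] = f [] * g [] := by simp [mul_apply]

/-- Removal of a first letter `a`. -/
def tail (a : ℕ) (f : NCSeries K) : NCSeries K := fun w => f (a :: w)

theorem mul_cons (f g : NCSeries K) (a : ℕ) (w : List ℕ) :
    (f * g) (a :: w) = f [] * g (a :: w) + (tail a f * g) w := by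
  rw [mul_apply, mul_apply, List.length_cons, Finset.sum_range_succ']
  simp [tail, add_comm]

theorem tail_mul (f g : NCSeries K) (a : ℕ) :
    tail a (f * g) = f [] • tail a g + tail a f * g := by
  ext w; simp [tail, mul_cons f g a w]

theorem add_mul' (f g h : NCSeries K) : (f + g) * h = f * h + g * h := by
  ext w; simp [mul_apply, add_mul, Finset.sum_add_distrib]

theorem mul_add' (f g h : NCSeries K) : f * (g + h) = f * g + f * h := by
  ext w; simp [mul_apply, mul_add, Finset.sum_add_distrib]

theorem smul_mul' (r : K) (f g : NCSeries K) : (r • f) * g = r • (f * g) := by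
  ext w; simp [mul_apply, Finset.mul_sum, mul_assoc]

theorem mul_smul' (r : K) (f g : NCSeries K) : f * (r • g) = r • (f * g) := by
  ext w; simp [mul_apply, Finset.mul_sum, mul_left_comm]

theorem mul_assoc' (f g h : NCSeries K) : f * g * h = f * (g * h) := by
  ext w
  induction w generalizing f with
  | nil => simp [mul_nil, mul_assoc]
  | cons a w ih =>
    rw [mul_cons, mul_nil, tail_mul, add_mul', smul_mul', add_apply, smul_apply, ih,
      mul_cons f, mul_cons g]
    ring

theorem one_mul' (f : NCSeries K) : 1 * f = f := by
  ext w
  rw [mul_apply, Finset.sum_eq_single 0]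
  · simp [one_apply]
  · intro i hi h0
    have : w.take i ≠ [] := by
      intro h
      rw [List.take_eq_nil_iff] at h
      rcases h with h | h
      · exact h0 h
      · subst h; simp at hi; exact h0 hi
    simp [one_apply, this]
  · simp

theorem mul_one' (f : NCSeries K) : f * 1 = f := by
  ext w
  rw [mul_apply, Finset.sum_eq_single w.length]
  · simp [one_apply]
  · intro i hi h0
    have : w.drop i ≠ [] := by
      intro h
      rw [List.drop_eq_nil_iff] at h
      simp at hi; omega
    simp [one_apply, this]
  · simp

instance : Ring (NCSeries K) where
  __ := (inferInstance : AddCommGroup (NCSeries K))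
  left_distrib := mul_add'
  right_distrib := add_mul'
  zero_mul f := by ext w; simp [mul_apply]
  mul_zero f := by ext w; simp [mul_apply]
  mul_assoc := mul_assoc'
  one_mul := one_mul'
  mul_one := mul_one'

instance : Algebra K (NCSeries K) := Algebra.ofModule smul_mul' mul_smul'

end NCSeries

/-! ### Symmetric functions in noncommuting variables -/

section WSym

variable (K : Type*) [Field K]

open Classical in
/-- `M_π`: the sum of the words `a₁ ⋯ a_n` such that `a_i = a_j` iff `i` and `j` are in the same
block of `π`. -/
def orbitSum {n : ℕ} (π : SetPartition n) : NCSeries K := fun w =>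
  if w.length = n ∧ ∀ i j : Fin n, w[(i : ℕ)]? = w[(j : ℕ)]? ↔ π.part i = π.part j then 1 else 0

/-- The linear span of the `M_π`, over all set partitions of all sizes. -/
def WSymSpan : Submodule K (NCSeries K) :=
  Submodule.span K {f | ∃ (n : ℕ) (π : SetPartition n), f = orbitSum K π}

/-! The next facts show that this span is closed under products. -/

/-- Two words have the same equalities between letters. -/
def SamePattern (u v : List ℕ) : Prop :=
  u.length = v.length ∧ ∀ i j : ℕ, u[i]? = u[j]? ↔ v[i]? = v[j]?

theorem SamePattern.take {u v : List ℕ} (h : SamePattern u v) (k : ℕ) :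
    SamePattern (u.take k) (v.take k) := by
  refine ⟨by simp [h.1], fun i j => ?_⟩
  have h1 := h.1
  have h2 := h.2 i j
  simp only [List.getElem?_take]
  split_ifs <;> simp_all

theorem SamePattern.drop {u v : List ℕ} (h : SamePattern u v) (k : ℕ) :
    SamePattern (u.drop k) (v.drop k) := by
  refine ⟨by simp [h.1], fun i j => ?_⟩
  simpa only [List.getElem?_drop] using h.2 (k + i) (k + j)

variable {K}

theorem samePattern_of_fin {u v : List ℕ} (h : u.length = v.length)
    (h' : ∀ i j : Fin u.length, u[(i : ℕ)]? = u[(j : ℕ)]? ↔ v[(i : ℕ)]? = v[(j : ℕ)]?) :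
    SamePattern u v := by
  refine ⟨h, fun i j => ?_⟩
  by_cases hi : i < u.length <;> by_cases hj : j < u.length
  · exact h' ⟨i, hi⟩ ⟨j, hj⟩
  · have hi' : i < v.length := h ▸ hi
    have hj' : v.length ≤ j := by omega
    have hj'' : u.length ≤ j := by omega
    simp [List.getElem?_eq_none hj', List.getElem?_eq_none hj'', hi, hi']
  · have hi' : v.length ≤ i := by omega
    have hi'' : u.length ≤ i := by omega
    have hj' : j < v.length := h ▸ hj
    simp [List.getElem?_eq_none hi', List.getElem?_eq_none hi'', hj, hj']
  · rw [List.getElem?_eq_none (by omega), List.getElem?_eq_none (by omega),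
      List.getElem?_eq_none (by omega), List.getElem?_eq_none (by omega)]

theorem setPartition_ext {n : ℕ} {π ρ : SetPartition n}
    (h : ∀ i j, π.part i = π.part j ↔ ρ.part i = ρ.part j) : π = ρ := by
  have hp : ∀ i, π.part i = ρ.part i := by
    intro i
    ext j
    rw [π.mem_part_iff_part_eq_part (Finset.mem_univ j) (Finset.mem_univ i),
      ρ.mem_part_iff_part_eq_part (Finset.mem_univ j) (Finset.mem_univ i), h]
  have key : ∀ σ : SetPartition n, ∀ t, t ∈ σ.parts ↔ ∃ i, σ.part i = t := by
    intro σ t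
    constructor
    · intro ht
      obtain ⟨i, hi⟩ := σ.nonempty_of_mem_parts ht
      exact ⟨i, σ.part_eq_of_mem ht hi⟩
    · rintro ⟨i, rfl⟩
      exact σ.part_mem.2 (Finset.mem_univ i)
  apply Finpartition.ext
  ext t
  rw [key, key]
  simp only [hp]

theorem exists_orbitSum (w : List ℕ) :
    ∃ π : SetPartition w.length, orbitSum K π w = 1 := by
  classical
  refine ⟨Finpartition.ofSetoid (Setoid.ker fun i : Fin w.length => w[(i : ℕ)]?), ?_⟩
  rw [orbitSum, if_pos]
  refine ⟨rfl, fun i j => ?_⟩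
  rw [← Finpartition.mem_part_iff_part_eq_part _ (Finset.mem_univ i) (Finset.mem_univ j),
    Finpartition.mem_part_ofSetoid_iff_rel]
  exact eq_comm

theorem orbitSum_samePattern {n : ℕ} (π : SetPartition n) {u v : List ℕ} (h : SamePattern u v) :
    orbitSum K π u = orbitSum K π v := by
  simp only [orbitSum, h.1, h.2]

theorem orbitSum_of_ne {n : ℕ} (π : SetPartition n) {w : List ℕ} (h : w.length ≠ n) :
    orbitSum K π w = 0 := by
  simp [orbitSum, h]

theorem samePattern_of_orbitSum {n : ℕ} {π : SetPartition n} {u v : List ℕ}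
    (hu : orbitSum K π u ≠ 0) (hv : orbitSum K π v ≠ 0) : SamePattern u v := by
  unfold orbitSum at hu hv
  split_ifs at hu hv with h1 h2
  · obtain ⟨rfl, h1⟩ := h1
    exact samePattern_of_fin h2.1.symm fun i j => (h1 i j).trans (h2.2 i j).symm
  all_goals simp at hu hv

theorem eq_of_orbitSum {n : ℕ} {π ρ : SetPartition n} {w : List ℕ}
    (hπ : orbitSum K π w ≠ 0) (hρ : orbitSum K ρ w ≠ 0) : π = ρ := by
  unfold orbitSum at hπ hρ
  split_ifs at hπ hρ with h1 h2
  · exact setPartition_ext fun i j => (h1.2 i j).symm.trans (h2.2 i j)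
  all_goals simp at hπ hρ

theorem mem_WSymSpan_iff {f : NCSeries K} :
    f ∈ WSymSpan K ↔ (∃ N, ∀ w : List ℕ, N ≤ w.length → f w = 0) ∧
      ∀ u v, SamePattern u v → f u = f v := by
  classical
  constructor
  · intro hf
    refine Submodule.span_induction ?_ ?_ ?_ ?_ hf
    · rintro _ ⟨n, π, rfl⟩
      exact ⟨⟨n + 1, fun w hw => orbitSum_of_ne π (by omega)⟩,
        fun u v h => orbitSum_samePattern π h⟩
    · exact ⟨⟨0, fun _ _ => rfl⟩, fun _ _ _ => rfl⟩
    · rintro f g - - ⟨⟨N, hN⟩, hf⟩ ⟨⟨M, hM⟩, hg⟩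
      refine ⟨⟨N + M, fun w hw => ?_⟩, fun u v h => ?_⟩
      · simp [hN w (by omega), hM w (by omega)]
      · simp [hf u v h, hg u v h]
    · rintro r f - ⟨⟨N, hN⟩, hf⟩
      refine ⟨⟨N, fun w hw => ?_⟩, fun u v h => ?_⟩
      · simp [hN w hw]
      · simp [hf u v h]
  · rintro ⟨⟨N, hN⟩, hf⟩
    let a : ∀ n, SetPartition n → K := fun n π =>
      if h : ∃ w, orbitSum K π w ≠ 0 then f h.choose else 0
    have : f = ∑ n ∈ Finset.range N, ∑ π : SetPartition n, a n π • orbitSum K π := by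
      have ev : ∀ {ι : Type} (s : Finset ι) (g : ι → NCSeries K) (w : List ℕ),
          (∑ i ∈ s, g i) w = ∑ i ∈ s, g i w := by
        intro ι s g w
        induction s using Finset.induction_on with
        | empty => simp
        | insert i s hi ih => rw [Finset.sum_insert hi, Finset.sum_insert hi,
            NCSeries.add_apply, ih]
      ext w
      simp only [ev, NCSeries.smul_apply]
      by_cases hw : w.length < N
      · rw [Finset.sum_eq_single_of_mem w.length (Finset.mem_range.2 hw)]
        · obtain ⟨π, hπ⟩ := exists_orbitSum (K := K) w
          have hne : orbitSum K π w ≠ 0 := by simp [hπ]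
          rw [Finset.sum_eq_single π]
          · have h : ∃ w, orbitSum K π w ≠ 0 := ⟨w, hne⟩
            rw [hπ, mul_one]
            simp only [a, dif_pos h]
            exact hf _ _ (samePattern_of_orbitSum hne h.choose_spec)
          · intro ρ _ hρ
            by_cases h0 : orbitSum K ρ w = 0
            · rw [h0, mul_zero]
            · exact absurd (eq_of_orbitSum h0 hne) hρ
          · simp
        · intro n _ hn
          exact Finset.sum_eq_zero fun π _ => by rw [orbitSum_of_ne π hn.symm, mul_zero]
      · rw [hN w (by omega)]
        refine (Finset.sum_eq_zero fun n hn => Finset.sum_eq_zero fun π _ => ?_).symm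
        rw [Finset.mem_range] at hn
        have h0 : orbitSum K π w = 0 := orbitSum_of_ne π (by omega)
        simp [h0]
    rw [this]
    exact Submodule.sum_mem _ fun n _ => Submodule.sum_mem _ fun π _ =>
      Submodule.smul_mem _ _ (Submodule.subset_span ⟨n, π, rfl⟩)

theorem one_mem_WSymSpan : (1 : NCSeries K) ∈ WSymSpan K := by
  refine mem_WSymSpan_iff.2 ⟨⟨1, fun w hw => ?_⟩, fun u v h => ?_⟩
  · rw [NCSeries.one_apply, if_neg]
    rintro rfl
    simp at hw
  · rw [NCSeries.one_apply, NCSeries.one_apply]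
    simp only [← List.length_eq_zero_iff, h.1]

theorem mul_mem_WSymSpan {f g : NCSeries K} (hf : f ∈ WSymSpan K) (hg : g ∈ WSymSpan K) :
    f * g ∈ WSymSpan K := by
  rw [mem_WSymSpan_iff] at hf hg ⊢
  obtain ⟨⟨N, hN⟩, hf⟩ := hf
  obtain ⟨⟨M, hM⟩, hg⟩ := hg
  refine ⟨⟨N + M, fun w hw => ?_⟩, fun u v h => ?_⟩
  · rw [NCSeries.mul_apply]
    refine Finset.sum_eq_zero fun i hi => ?_
    rw [Finset.mem_range] at hi
    by_cases hiN : N ≤ i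
    · rw [hN (w.take i) (by simp; omega), zero_mul]
    · rw [hM (w.drop i) (by simp; omega), mul_zero]
  · rw [NCSeries.mul_apply, NCSeries.mul_apply, h.1]
    exact Finset.sum_congr rfl fun i _ => by rw [hf _ _ (h.take i), hg _ _ (h.drop i)]

variable (K)

/-- The algebra `WSym` of symmetric functions in noncommuting variables: the span of the `M_π`
with the product of noncommutative power series. -/
def WSym : Subalgebra K (NCSeries K) :=
  (WSymSpan K).toSubalgebra one_mem_WSymSpan fun _ _ => mul_mem_WSymSpan

/-- `M_π` as an element of `WSym`. -/
def M {n : ℕ} (π : SetPartition n) : WSym K :=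
  ⟨orbitSum K π, Submodule.subset_span ⟨n, π, rfl⟩⟩

variable {K}

/-- The value of a symmetric `f` on a disjoint union `A' ⊔ A''` of two infinite alphabets which
commute with each other: the coefficient of `u' v''` for a word `u` over `A'` and a word `v`
over `A''`. Here `A'` is the set of even numbers and `A''` the set of odd numbers, each of them
being identified with `ℕ`. -/
def doubling (f : NCSeries K) (u v : List ℕ) : K :=
  ((shuffle (u.map fun x => 2 * x) (v.map fun x => 2 * x + 1)).map f).sum

/-- The coefficient of `u ⊗ v` in an element of `WSym ⊗ WSym`. -/
def tensorCoeff (u v : List ℕ) : WSym K ⊗[K] WSym K →ₗ[K] K :=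
  TensorProduct.lift (LinearMap.mk₂ K (fun f g : WSym K => f.1 u * g.1 v)
    (fun f f' g => by simp [add_mul]) (fun r f g => by simp [mul_assoc])
    (fun f g g' => by simp [mul_add]) (fun r f g => by simp [mul_left_comm]))

/-- `t` is the coproduct of `f` in `WSym`, that is `f(A' ⊔ A'')` read in `WSym ⊗ WSym`. -/
def IsCoproduct (f : WSym K) (t : WSym K ⊗[K] WSym K) : Prop :=
  ∀ u v : List ℕ, tensorCoeff u v t = doubling f.1 u v

end WSym

/-! ### Noncommutative symmetric functions and quasi-symmetric functions -/

section Sym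

variable (K : Type*) [Field K]

/-- The algebra of noncommutative symmetric functions: the free associative algebra on the
complete functions `S₁, S₂, …`. -/
abbrev NSym := FreeAlgebra K ℕ+

/-- The complete function `S_n`, with `S_0 = 1`. -/
def S (n : ℕ) : NSym K := if h : 0 < n then FreeAlgebra.ι K ⟨n, h⟩ else 1

/-- The coproduct, the algebra map with `Δ S_n = ∑_{i + j = n} S_i ⊗ S_j`. -/
def nsymCoproduct : NSym K →ₐ[K] NSym K ⊗[K] NSym K :=
  FreeAlgebra.lift K fun n : ℕ+ =>
    ∑ i ∈ Finset.range ((n : ℕ) + 1), S K i ⊗ₜ[K] S K ((n : ℕ) - i)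

/-- The product `S^I = S_{i₁} ⋯ S_{i_r}`. -/
def Sprod (I : List ℕ) : NSym K := (I.map (S K)).prod

/-- The homogeneous component of degree `n`, spanned by the `S^I` for `I` a composition of `n`. -/
def nsymDegree (n : ℕ) : Submodule K (NSym K) :=
  Submodule.span K (Set.range fun I : Composition n => Sprod K I.blocks)

/-- The quasi-monomial function `∑_{n₁ < ⋯ < n_r} x_{n₁}^{i₁} ⋯ x_{n_r}^{i_r}` in the variables
`x₀, x₁, x₂, …`: the coefficient of a monomial is `1` if its nonzero exponents, read in the order
of the variables, form the list `I`, and `0` otherwise. -/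
def quasiMonomial (I : List ℕ) : MvPowerSeries ℕ K := fun m =>
  if (m.support.sort (· ≤ ·)).map m = I then 1 else 0

/-- The space of quasi-symmetric functions, the span of the quasi-monomial functions `M_I`. -/
def QSym : Submodule K (MvPowerSeries ℕ K) :=
  Submodule.span K {F | ∃ (n : ℕ) (I : Composition n), F = quasiMonomial K I.blocks}

variable {K}

/-- The duality bracket between quasi-symmetric functions and noncommutative symmetric functions,
for which `⟨M_I, S^J⟩ = δ_{IJ}`: the value of `⟨F, S^J⟩` is the coefficient of
`x₀^{j₁} x₁^{j₂} ⋯` in `F`, which is the coefficient of `M_J` in `F`. -/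
def pairing (F : MvPowerSeries ℕ K) : NSym K →ₗ[K] K :=
  (FreeAlgebra.basisFreeMonoid K ℕ+).constr K fun J : FreeMonoid ℕ+ =>
    MvPowerSeries.coeff (J.toList.map fun j : ℕ+ => (j : ℕ)).toFinsupp F

/-- `p : WSym → NSym` is a realization of `NSym` as the stalactic quotient of `WSym`: the map `p`
is a surjective morphism of graded Hopf algebras, whose kernel is the two-sided ideal generated by
the differences `M_π - M_π'` with `K(π) = K(π')`. Equivalently, `p` induces an isomorphism of
graded Hopf algebras from the quotient of `WSym` by this ideal onto `NSym`. (Preservation of the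
counit and of the antipode follows from that of the degree, the product and the coproduct.) -/
structure IsStalacticQuotient (p : WSym K →ₐ[K] NSym K) : Prop where
  surjective : Function.Surjective p
  ker_eq : TwoSidedIdeal.ker p = TwoSidedIdeal.span
    {x : WSym K | ∃ (n : ℕ) (π π' : SetPartition n),
      sizeComp π = sizeComp π' ∧ x = M K π - M K π'}
  map_degree : ∀ (n : ℕ) (π : SetPartition n), p (M K π) ∈ nsymDegree K n
  map_coproduct : ∀ f : WSym K, ∃ t : WSym K ⊗[K] WSym K, IsCoproduct f t ∧
    nsymCoproduct K (p f) = TensorProduct.map p.toLinearMap p.toLinearMap t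

end Sym

end BinaryShuffle

end

open BinaryShuffle

/-! Set partitions are replaced by words up to renaming of letters: $\mathbf M_\pi$ is the sum of
one orbit of words. On a word of pattern $\pi$, $K(\pi)$ becomes `content`, and $C(\pi)$, written in
binary by `binWord`, becomes `lastBits`.

Product rule, for a given quotient map p. The element $X_J$ is the image of `lastSum`, the sum of
all words whose last occurrences sit at the ones of $\epsilon_J$ (`lastSum_eq_sum`,
`IsStalacticQuotient.lastSum_eq`). When two words over disjoint alphabets are shuffled, a letter is
a last occurrence exactly when it is one in its own word, so `lastBits` carries shuffles to
shuffles. Hence $\Delta X_J$ is the sum over the unshufflings of $\epsilon_J$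
(`isCoproduct_lastSum`), where binary words ending in 0 contribute nothing. The product of $QSym$ is
dual to $\Delta$ (`coeff_mul_eq`) and unshuffling is dual to shuffling (`count_unshuffle`); this is
the rule for the dual basis $Z$.

Bases. The $V_I$ span because p is surjective; they are homogeneous and indexed like the $S^I$, so
dimension counting makes them a basis (`linearIndependent_of_homogeneous`). The $X_J$ are obtained
from the $V_I$ by a triangular matrix with nonzero diagonal, when compositions are ordered by the
binary value of $\epsilon_I$ (`bitsVal_lt_of_c_ne_zero`, `c_self_ne_zero`).

Existence of p. Primitive power sums $P_i$ of $\mathbf{Sym}$ define elements `Vlist` through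
$P_iV_J=V_{iJ}+\sum V_{J'}$, the recursion satisfied in $\mathbf{WSym}$ by left multiplication by
the one-block function of size i. The linear map $\mathbf M_\pi\mapsto V_{K(\pi)}$ therefore
commutes with left multiplication by lifts of elements of $\mathbf{Sym}$
(`stalacticMap_nsymLift_mul`), and is onto. Its kernel is spanned by the differences with equal
`content`, and is a right ideal, because a prefix can be replaced by another of equal content
without changing the content of the whole word (`stalacticMap_Mword_mul_congr`). Together these give
multiplicativity. The coproducts agree because splitting the set of letters of a word unshuffles its
content (`isCoproduct_Mword`, `nsymCoproduct_Vlist`). -/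

open scoped TensorProduct
noncomputable section
namespace BinaryShuffle

/-! ### Words up to renaming of the letters -/

/-- The multiplicities of the letters of a word, ordered by their last occurrences. -/
def content (w : List ℕ) : List ℕ := w.dedup.map fun a => w.count a

/-- The binary word whose ones are at the last occurrences of the letters. -/
def lastBits : List ℕ → List Bool
  | [] => []
  | a :: w => decide (a ∉ w) :: lastBits w

theorem SamePattern.refl (u : List ℕ) : SamePattern u u := ⟨rfl, fun _ _ => Iff.rfl⟩

theorem SamePattern.symm {u v : List ℕ} (h : SamePattern u v) : SamePattern v u :=
  ⟨h.1.symm, fun i j => (h.2 i j).symm⟩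

theorem SamePattern.trans {u v w : List ℕ} (h : SamePattern u v) (h' : SamePattern v w) :
    SamePattern u w :=
  ⟨h.1.trans h'.1, fun i j => (h.2 i j).trans (h'.2 i j)⟩

theorem samePattern_map {u : List ℕ} {s : ℕ → ℕ} (hs : Function.Injective s) :
    SamePattern u (u.map s) := by
  refine ⟨by simp, fun i j => ?_⟩
  simp only [List.getElem?_map]
  exact (Option.map_injective hs).eq_iff.symm

/-- Induction on the word: if the first letter recurs, the permutation found for the tail already
works; otherwise it is followed by a transposition which moves no letter of the image of the tail.
Pattern invariance is thereby reduced to equivariance under permutations of the alphabet. -/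
theorem SamePattern.exists_perm {u v : List ℕ} (h : SamePattern u v) :
    ∃ s : Equiv.Perm ℕ, v = u.map s := by
  induction u generalizing v with
  | nil =>
    have := h.1
    exact ⟨1, by simpa using (List.length_eq_zero_iff.1 this.symm)⟩
  | cons a u ih =>
    obtain _ | ⟨b, v⟩ := v
    · simpa using h.1
    have hd : SamePattern u v := by simpa using h.drop 1
    obtain ⟨s, rfl⟩ := ih hd
    by_cases ha : a ∈ u
    · obtain ⟨k, hk⟩ := List.mem_iff_getElem?.1 ha
      refine ⟨s, ?_⟩
      have := (h.2 0 (k + 1)).1 (by simp [hk])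
      simp [hk] at this
      simp [this]
    · have hb : b ∉ u.map s := by
        intro hb
        obtain ⟨k, hk⟩ := List.mem_iff_getElem?.1 hb
        have := (h.2 0 (k + 1)).2 (by simpa using hk.symm)
        exact ha (List.mem_iff_getElem?.2 ⟨k, by simpa using this.symm⟩)
      refine ⟨s.trans (Equiv.swap (s a) b), ?_⟩
      simp only [List.map_cons, Equiv.trans_apply, Equiv.swap_apply_left, List.cons.injEq, true_and]
      refine List.map_congr_left fun x hx => ?_
      rw [Equiv.trans_apply, Equiv.swap_apply_of_ne_of_ne]
      · rintro e
        exact ha (s.injective e ▸ hx)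
      · rintro rfl
        exact hb (List.mem_map_of_mem hx)

theorem samePattern_of_nodup {u v : List ℕ} (hu : u.Nodup) (hv : v.Nodup)
    (h : u.length = v.length) : SamePattern u v := by
  refine samePattern_of_fin h fun i j => ?_
  rw [List.getElem?_eq_getElem i.2, List.getElem?_eq_getElem j.2,
    List.getElem?_eq_getElem (h ▸ i.2), List.getElem?_eq_getElem (h ▸ j.2)]
  simp [hu.getElem_inj_iff, hv.getElem_inj_iff]

theorem dedup_map_perm (w : List ℕ) (s : Equiv.Perm ℕ) : (w.map s).dedup = w.dedup.map s :=
  List.dedup_map_of_injective s.injective w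

theorem count_map_perm (w : List ℕ) (s : Equiv.Perm ℕ) (a : ℕ) :
    (w.map s).count (s a) = w.count a :=
  List.count_map_of_injective w s s.injective a

theorem SamePattern.content_eq {u v : List ℕ} (h : SamePattern u v) : content u = content v := by
  obtain ⟨s, rfl⟩ := h.exists_perm
  simp only [content, dedup_map_perm, List.map_map]
  exact List.map_congr_left fun a _ => (count_map_perm u s a).symm

theorem lastBits_map (w : List ℕ) {s : ℕ → ℕ} (hs : Function.Injective s) :
    lastBits (w.map s) = lastBits w := by
  induction w with
  | nil => rfl
  | cons a w ih => simp [lastBits, ih, hs.eq_iff]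

theorem SamePattern.lastBits_eq {u v : List ℕ} (h : SamePattern u v) :
    lastBits u = lastBits v := by
  obtain ⟨s, rfl⟩ := h.exists_perm
  exact (lastBits_map u s.injective).symm

@[simp] theorem length_lastBits (w : List ℕ) : (lastBits w).length = w.length := by
  induction w with
  | nil => rfl
  | cons a w ih => simp [lastBits, ih]

theorem pos_of_mem_content {w : List ℕ} {i : ℕ} (h : i ∈ content w) : 0 < i := by
  simp only [content, List.mem_map, List.mem_dedup] at h
  obtain ⟨a, ha, rfl⟩ := h
  exact List.count_pos_iff.2 ha

theorem sum_content (w : List ℕ) : (content w).sum = w.length := by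
  rw [content, ← List.sum_toFinset _ w.nodup_dedup, ← List.sum_toFinset_count_eq_length]
  exact Finset.sum_congr (by ext; simp) fun _ _ => rfl

/-- A composition with a given list of blocks. -/
def compOf (L : List ℕ) (h : ∀ i ∈ L, 0 < i) : Composition L.sum := ⟨L, fun {i} hi => h i hi, rfl⟩

/-- The multiplicities of a word as a composition of its length. -/
def contentComp (w : List ℕ) : Composition w.length :=
  ⟨content w, fun {_} hi => pos_of_mem_content hi, sum_content w⟩

theorem dedup_append' (u v : List ℕ) :
    (u ++ v).dedup = u.dedup.filter (fun a => a ∉ v) ++ v.dedup := by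
  induction u with
  | nil => simp
  | cons a u ih =>
    by_cases ha : a ∈ u
    · rw [List.cons_append, List.dedup_cons_of_mem (by simp [ha]), List.dedup_cons_of_mem ha, ih]
    · by_cases hv : a ∈ v
      · rw [List.cons_append, List.dedup_cons_of_mem (by simp [hv]), List.dedup_cons_of_notMem ha,
          ih, List.filter_cons_of_neg (by simpa using hv)]
      · rw [List.cons_append, List.dedup_cons_of_notMem (by simp [ha, hv]),
          List.dedup_cons_of_notMem ha, ih, List.filter_cons_of_pos (by simpa using hv),
          List.cons_append]

/-- A word whose letters are `0, 1, …` in the order of their last occurrences. -/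
def Canon (w : List ℕ) : Prop := w.dedup = List.range w.dedup.length

theorem exists_canon (w : List ℕ) : ∃ v, Canon v ∧ SamePattern w v := by
  obtain ⟨s, hs⟩ := (samePattern_of_nodup w.nodup_dedup
    (List.nodup_range (n := w.dedup.length)) (by simp)).exists_perm
  refine ⟨w.map s, ?_, samePattern_map s.injective⟩
  rw [Canon, dedup_map_perm, ← hs, List.length_range]

theorem map_eq_self {l : List ℕ} {s : ℕ → ℕ} (h : ∀ a ∈ l, s a = a) : l.map s = l :=
  (List.map_congr_left h).trans (List.map_id l)

/-- The relabelling permutation maps the list 0, 1, … of letters to itself in order, so it fixes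
every letter. Canonical words are thus unique representatives of patterns and can index a basis. -/
theorem Canon.eq_of_samePattern {u v : List ℕ} (hu : Canon u) (hv : Canon v)
    (h : SamePattern u v) : u = v := by
  obtain ⟨s, rfl⟩ := h.exists_perm
  have e := dedup_map_perm u s
  have hl : (u.map s).dedup.length = u.dedup.length := by rw [e, List.length_map]
  rw [Canon, hl, ← hu, e] at hv
  refine (map_eq_self fun a ha => ?_).symm
  exact List.map_inj_left.1 (hv.trans (List.map_id _).symm) a (List.mem_dedup.2 ha)

/-- The word `0^{i₁} 1^{i₂} ⋯`, with letters starting from `k`. -/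
def intervalWord (k : ℕ) : List ℕ → List ℕ
  | [] => []
  | i :: I => List.replicate i k ++ intervalWord (k + 1) I

theorem le_of_mem_intervalWord {k : ℕ} {I : List ℕ} {a : ℕ} (h : a ∈ intervalWord k I) :
    k ≤ a := by
  induction I generalizing k with
  | nil => simp [intervalWord] at h
  | cons i I ih =>
    simp only [intervalWord, List.mem_append, List.mem_replicate] at h
    rcases h with h | h
    · exact h.2.ge
    · exact (Nat.le_succ k).trans (ih h)

theorem dedup_replicate {i : ℕ} (hi : 0 < i) (a : ℕ) : (List.replicate i a).dedup = [a] := by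
  obtain ⟨i, rfl⟩ := Nat.exists_eq_succ_of_ne_zero hi.ne'
  induction i with
  | zero => simp
  | succ i ih => rw [List.replicate_succ, List.dedup_cons_of_mem (by simp), ih (by simp)]

theorem content_fresh_append {i a : ℕ} (hi : 0 < i) {v : List ℕ} (ha : a ∉ v) :
    content (List.replicate i a ++ v) = i :: content v := by
  rw [content, dedup_append', dedup_replicate hi, List.filter_cons_of_pos (by simpa using ha)]
  simp only [List.filter_nil, List.cons_append, List.nil_append, List.map_cons, List.count_append,
    List.count_replicate_self, List.count_eq_zero_of_not_mem ha, add_zero, content]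
  congr 1
  refine List.map_congr_left fun b hb => ?_
  rw [List.count_replicate, if_neg, zero_add]
  rintro e
  rw [List.mem_dedup] at hb
  simp at e
  exact ha (e ▸ hb)

theorem content_intervalWord (k : ℕ) {I : List ℕ} (hI : ∀ i ∈ I, 0 < i) :
    content (intervalWord k I) = I := by
  induction I generalizing k with
  | nil => simp [intervalWord, content]
  | cons i I ih =>
    rw [intervalWord, content_fresh_append (hI i (by simp)), ih _ fun j hj => hI j (by simp [hj])]
    intro h
    have := le_of_mem_intervalWord h
    omega

theorem lastBits_replicate_append {i a : ℕ} (hi : 0 < i) {v : List ℕ} (ha : a ∉ v) :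
    lastBits (List.replicate i a ++ v) = List.replicate (i - 1) false ++ true :: lastBits v := by
  obtain ⟨i, rfl⟩ := Nat.exists_eq_succ_of_ne_zero hi.ne'
  induction i with
  | zero => simp [lastBits, ha]
  | succ i ih =>
    rw [List.replicate_succ, List.cons_append, lastBits, ih (by simp)]
    simp [List.replicate_succ]

theorem binWord_cons (i : ℕ) (I : List ℕ) :
    binWord (i :: I) = List.replicate (i - 1) false ++ true :: binWord I := by
  simp [binWord]

theorem lastBits_intervalWord (k : ℕ) {I : List ℕ} (hI : ∀ i ∈ I, 0 < i) :
    lastBits (intervalWord k I) = binWord I := by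
  induction I generalizing k with
  | nil => rfl
  | cons i I ih =>
    rw [intervalWord, lastBits_replicate_append (hI i (by simp)),
      ih _ fun j hj => hI j (by simp [hj]), binWord_cons]
    intro h
    have := le_of_mem_intervalWord h
    omega

theorem length_binWord {I : List ℕ} (hI : ∀ i ∈ I, 0 < i) : (binWord I).length = I.sum := by
  induction I with
  | nil => rfl
  | cons i I ih =>
    have := hI i (by simp)
    rw [binWord_cons, List.length_append, List.length_cons, ih fun j hj => hI j (by simp [hj]),
      List.length_replicate, List.sum_cons]
    omega

/-- Addition of `1` to the first part. -/
def bump : List ℕ → List ℕ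
  | [] => []
  | i :: I => (i + 1) :: I

theorem binWord_bump {I : List ℕ} (hI : ∀ i ∈ I, 0 < i) (h : I ≠ []) :
    binWord (bump I) = false :: binWord I := by
  obtain _ | ⟨i, I⟩ := I
  · exact absurd rfl h
  have := hI i (by simp)
  obtain ⟨i, rfl⟩ := Nat.exists_eq_succ_of_ne_zero this.ne'
  simp [bump, binWord_cons, List.replicate_succ]

/-- A binary word which is empty or ends with `1` comes from a composition. -/
theorem exists_binWord (b : List Bool) (hb : b.getLast? ≠ some false) :
    ∃ I : List ℕ, (∀ i ∈ I, 0 < i) ∧ binWord I = b := by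
  induction b with
  | nil => exact ⟨[], by simp, rfl⟩
  | cons x b ih =>
    have hb' : b.getLast? ≠ some false := by
      cases b with
      | nil => simp
      | cons y b => simpa [List.getLast?_cons_cons] using hb
    obtain ⟨I, hI, rfl⟩ := ih hb'
    cases x with
    | true =>
      exact ⟨1 :: I, by simpa using hI, by simp [binWord_cons]⟩
    | false =>
      have hne : I ≠ [] := by
        rintro rfl
        simp [binWord] at hb
      refine ⟨bump I, ?_, binWord_bump hI hne⟩
      obtain _ | ⟨i, I⟩ := I
      · simp [bump]
      · simp only [bump, List.mem_cons, forall_eq_or_imp] at hI ⊢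
        exact ⟨by omega, hI.2⟩

/-- The number of zeros before the first one recovers the first part. Positivity matters because the
truncated `i - 1` would identify the parts 0 and 1. -/
theorem binWord_injective {I J : List ℕ} (hI : ∀ i ∈ I, 0 < i) (hJ : ∀ i ∈ J, 0 < i)
    (h : binWord I = binWord J) : I = J := by
  have key : ∀ {i j : ℕ} {u v : List Bool}, List.replicate i false ++ true :: u =
      List.replicate j false ++ true :: v → i = j ∧ u = v := by
    intro i
    induction i with
    | zero =>
      rintro (_ | j) u v h
      · simpa using h
      · simp [List.replicate_succ] at h
    | succ i ih =>
      rintro (_ | j) u v h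
      · simp [List.replicate_succ] at h
      · simp only [List.replicate_succ, List.cons_append, List.cons.injEq, true_and] at h
        obtain ⟨rfl, rfl⟩ := ih h
        exact ⟨rfl, rfl⟩
  induction I generalizing J with
  | nil =>
    obtain _ | ⟨j, J⟩ := J
    · rfl
    · simp [binWord] at h
  | cons i I ih =>
    obtain _ | ⟨j, J⟩ := J
    · simp [binWord] at h
    · rw [binWord_cons, binWord_cons] at h
      obtain ⟨h1, h2⟩ := key h
      have hi := hI i (by simp)
      have hj := hJ j (by simp)
      rw [ih (fun k hk => hI k (by simp [hk])) (fun k hk => hJ k (by simp [hk])) h2,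
        show i = j by omega]

/-- The final letter of a nonempty word is always a last occurrence. -/
theorem getLast?_lastBits (w : List ℕ) : (lastBits w).getLast? ≠ some false := by
  induction w with
  | nil => simp [lastBits]
  | cons a w ih =>
    cases w with
    | nil => simp [lastBits]
    | cons b w =>
      rw [lastBits]
      rw [lastBits] at ih ⊢
      rwa [List.getLast?_cons_cons]

/-! ### Comparison of the two compositions of a word -/

/-- The value of a binary word as a binary number. -/
def bitsVal : List Bool → ℕ
  | [] => 0
  | b :: w => (if b then 2 ^ w.length else 0) + bitsVal w

theorem bitsVal_lt (w : List Bool) : bitsVal w < 2 ^ w.length := by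
  induction w with
  | nil => simp [bitsVal]
  | cons b w ih =>
    rw [bitsVal, List.length_cons, pow_succ]
    split_ifs <;> omega

theorem bitsVal_inj {u v : List Bool} (hl : u.length = v.length) (h : bitsVal u = bitsVal v) :
    u = v := by
  induction u generalizing v with
  | nil => exact (List.length_eq_zero_iff.1 hl.symm).symm
  | cons a u ih =>
    obtain _ | ⟨b, v⟩ := v
    · simp at hl
    simp only [List.length_cons, add_left_inj] at hl
    simp only [bitsVal, hl] at h
    have h1 := bitsVal_lt u
    have h2 := bitsVal_lt v
    rw [hl] at h1
    have hab : a = b := by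
      cases a <;> cases b <;> simp at h ⊢ <;> omega
    subst hab
    rw [ih hl (by omega)]

theorem bitsVal_append_le {p u v : List Bool} (hl : u.length = v.length)
    (h : bitsVal u ≤ bitsVal v) : bitsVal (p ++ u) ≤ bitsVal (p ++ v) := by
  induction p with
  | nil => exact h
  | cons a p ih => simpa [bitsVal, hl] using ih

theorem bitsVal_false_replicate_le (i : ℕ) (u : List Bool) :
    bitsVal (false :: (List.replicate i false ++ true :: u)) ≤
      bitsVal (List.replicate i false ++ true :: false :: u) := by
  induction i with
  | zero => simp [bitsVal, pow_succ]
  | succ i ih => simpa [List.replicate_succ, bitsVal] using ih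

/-- Adding `1` to a part, the word `binWord` becomes at least `0` followed by the old word. -/
theorem bitsVal_increment (l : List ℕ) (hl : l.Nodup) (f : ℕ → ℕ) (hf : ∀ a ∈ l, 0 < f a) {b : ℕ}
    (hb : b ∈ l) :
    bitsVal (false :: binWord (l.map f)) ≤
      bitsVal (binWord (l.map fun a => f a + if a = b then 1 else 0)) := by
  induction l with
  | nil => simp at hb
  | cons a l ih =>
    have ha := hf a (by simp)
    obtain ⟨hal, hl'⟩ := List.nodup_cons.1 hl
    by_cases hab : a = b
    · subst hab
      have : (l.map fun x => f x + if x = a then 1 else 0) = l.map f :=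
        List.map_congr_left fun x hx => by
          rw [if_neg, add_zero]
          rintro rfl
          exact hal hx
      rw [List.map_cons, List.map_cons, this, if_pos rfl]
      exact (congrArg bitsVal (binWord_bump (I := f a :: l.map f) (by
        intro i hi
        rw [List.mem_cons, List.mem_map] at hi
        rcases hi with rfl | ⟨x, hx, rfl⟩
        · exact ha
        · exact hf x (by simp [hx])) (by simp))).ge
    · have hb' : b ∈ l := by simpa [Ne.symm hab] using hb
      have h := ih hl' (fun x hx => hf x (by simp [hx])) hb'
      have hlen : (false :: binWord (l.map f)).length =
          (binWord (l.map fun a => f a + if a = b then 1 else 0)).length := by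
        rw [List.length_cons, length_binWord, length_binWord, List.sum_map_add,
          ← List.sum_toFinset (fun a => if a = b then 1 else 0) hl', Finset.sum_ite_eq',
          if_pos (List.mem_toFinset.2 hb')]
        · intro i hi
          obtain ⟨x, hx, rfl⟩ := List.mem_map.1 hi
          exact Nat.add_pos_left (hf x (by simp [hx])) _
        · intro i hi
          obtain ⟨x, hx, rfl⟩ := List.mem_map.1 hi
          exact hf x (by simp [hx])
      rw [List.map_cons, List.map_cons, if_neg hab, add_zero, binWord_cons, binWord_cons]
      -- The increased part lies further right: the leading 0 is first moved past the 1 of the first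
      -- part, which cannot lower the value, and then the induction hypothesis applies behind that
      -- common prefix.
      refine (bitsVal_false_replicate_le _ _).trans (bitsVal_append_le ?_ ?_)
      · rw [List.length_cons, hlen, List.length_cons]
      · rw [bitsVal, bitsVal, hlen]
        exact Nat.add_le_add_left h _

/-- Prepending a new letter adds a leading 1 to both binary words. Prepending a letter already
present adds a leading 0 on the left and increases a part on the right, and `bitsVal_increment` says
that the latter gains at least as much. This is the source of the triangularity of the coefficients
c. -/
theorem bitsVal_lastBits_le (w : List ℕ) :
    bitsVal (lastBits w) ≤ bitsVal (binWord (content w)) := by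
  induction w with
  | nil => simp [lastBits, content, binWord]
  | cons a w ih =>
    have hlen : (lastBits w).length = (binWord (content w)).length := by
      rw [length_lastBits, length_binWord fun i hi => pos_of_mem_content hi, sum_content]
    by_cases ha : a ∈ w
    · have h1 : content (a :: w) =
          w.dedup.map fun x => w.count x + if x = a then 1 else 0 := by
        rw [content, List.dedup_cons_of_mem ha]
        refine List.map_congr_left fun x _ => ?_
        rw [List.count_cons]
        by_cases h : x = a
        · simp [h]
        · simp [h, Ne.symm h]
      rw [h1]
      refine le_trans ?_ (bitsVal_increment _ w.nodup_dedup _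
        (fun x hx => List.count_pos_iff.2 (List.mem_dedup.1 hx)) (List.mem_dedup.2 ha))
      rw [lastBits, decide_eq_false (by simpa using ha), bitsVal, bitsVal]
      simpa [content] using ih
    · have h1 := content_fresh_append one_pos ha
      rw [List.replicate_one, List.singleton_append] at h1
      rw [h1, binWord_cons]
      rw [lastBits, decide_eq_true ha, Nat.sub_self, List.replicate_zero, List.nil_append, bitsVal,
        bitsVal, hlen]
      exact Nat.add_le_add_left ih _

end BinaryShuffle
end

/-! ### Coordinates on WSym and duality of shuffles and unshuffles -/

open scoped TensorProduct
noncomputable section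
namespace BinaryShuffle

/-! ### The basis of `WSym` -/

variable {K : Type*} [Field K]

open Classical in
/-- The sum of the words with the same pattern as `w`. -/
def Mword (K : Type*) [Field K] (w : List ℕ) : WSym K :=
  ⟨fun v => if SamePattern w v then 1 else 0, mem_WSymSpan_iff.2 ⟨⟨w.length + 1, fun v hv =>
    if_neg fun h => by have := h.1; omega⟩, fun u v h => by
      have : SamePattern w u ↔ SamePattern w v := ⟨fun h' => h'.trans h, fun h' => h'.trans h.symm⟩
      simp only [this]⟩⟩

open Classical in
theorem Mword_apply (w v : List ℕ) :
    (Mword K w).1 v = if SamePattern w v then 1 else 0 := rfl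

theorem Mword_congr {u v : List ℕ} (h : SamePattern u v) : Mword K u = Mword K v := by
  refine Subtype.ext (NCSeries.ext fun w => ?_)
  have : SamePattern u w ↔ SamePattern v w := ⟨h.symm.trans, h.trans⟩
  rw [Mword_apply, Mword_apply]
  by_cases h' : SamePattern u w
  · rw [if_pos h', if_pos (this.1 h')]
  · rw [if_neg h', if_neg fun h'' => h' (this.2 h'')]

theorem M_eq_Mword {n : ℕ} {π : SetPartition n} {w : List ℕ} (h : orbitSum K π w ≠ 0) :
    M K π = Mword K w := by
  have h01 : ∀ v, orbitSum K π v = 0 ∨ orbitSum K π v = 1 := fun v => by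
    unfold orbitSum
    split_ifs <;> simp
  refine Subtype.ext (NCSeries.ext fun v => ?_)
  rw [Mword_apply]
  split_ifs with hv
  · change orbitSum K π v = 1
    rw [← orbitSum_samePattern π hv]
    exact (h01 w).resolve_left h
  · change orbitSum K π v = 0
    by_contra h0
    exact hv (samePattern_of_orbitSum h h0)

/-- A word with pattern `π`. -/
def wordOf {n : ℕ} (π : SetPartition n) : List ℕ :=
  List.ofFn fun i => ((π.part i).max' ⟨i, π.mem_part (Finset.mem_univ i)⟩ : Fin n).val

theorem wordOf_spec (K : Type*) [Field K] {n : ℕ} (π : SetPartition n) :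
    orbitSum K π (wordOf π) = 1 := by
  have key : ∀ i : Fin n, (π.part i).max' ⟨i, π.mem_part (Finset.mem_univ i)⟩ ∈ π.part i :=
    fun i => Finset.max'_mem _ _
  rw [orbitSum, if_pos]
  refine ⟨by simp [wordOf], fun i j => ?_⟩
  rw [List.getElem?_eq_getElem (by simp [wordOf]), List.getElem?_eq_getElem (by simp [wordOf])]
  simp only [wordOf, List.getElem_ofFn, Option.some.injEq, Fin.val_inj]
  constructor
  · intro h
    have hi := key i
    have hj := key j
    simp only [Fin.eta] at h
    rw [π.mem_part_iff_part_eq_part (Finset.mem_univ _) (Finset.mem_univ _)] at hi hj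
    rw [← hi, ← hj, h]
  · intro h
    simp only [Fin.eta, h]

theorem M_eq_Mword_wordOf {n : ℕ} (π : SetPartition n) : M K π = Mword K (wordOf π) :=
  M_eq_Mword (by rw [wordOf_spec]; exact one_ne_zero)

theorem length_wordOf {n : ℕ} (π : SetPartition n) : (wordOf π).length = n := by simp [wordOf]

theorem exists_M_eq_Mword (w : List ℕ) :
    ∃ π : SetPartition w.length, orbitSum K π w = 1 ∧ M K π = Mword K w := by
  obtain ⟨π, hπ⟩ := exists_orbitSum (K := K) w
  exact ⟨π, hπ, M_eq_Mword (by rw [hπ]; exact one_ne_zero)⟩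

theorem Mword_induction {P : WSym K → Prop} (h : ∀ w, P (Mword K w)) (h0 : P 0)
    (hadd : ∀ f g, P f → P g → P (f + g)) (hsmul : ∀ (r : K) f, P f → P (r • f)) (f : WSym K) :
    P f := by
  obtain ⟨f, hf⟩ := f
  change f ∈ WSymSpan K at hf
  induction hf using Submodule.span_induction with
  | mem f hf =>
    obtain ⟨n, π, rfl⟩ := hf
    have := h (wordOf π)
    rwa [← M_eq_Mword_wordOf] at this
  | zero => exact h0
  | add f g hf hg h1 h2 => exact hadd ⟨f, hf⟩ ⟨g, hg⟩ h1 h2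
  | smul r f hf h1 => exact hsmul r ⟨f, hf⟩ h1

/-- The value at a word as a linear form. -/
def evalWord (w : List ℕ) : WSym K →ₗ[K] K where
  toFun f := f.1 w
  map_add' _ _ := rfl
  map_smul' _ _ := rfl

@[simp] theorem evalWord_apply (w : List ℕ) (f : WSym K) : evalWord w f = f.1 w := rfl

theorem Mword_canon_apply (u v : {w : List ℕ // Canon w}) :
    (Mword K u.1).1 v.1 = if u = v then 1 else 0 := by
  classical
  rw [Mword_apply]
  congr 1
  exact propext ⟨fun h => Subtype.ext (u.2.eq_of_samePattern v.2 h),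
    fun h => h ▸ SamePattern.refl _⟩

/-- The basis of `WSym`, indexed by canonical words. -/
def Mbasis (K : Type*) [Field K] : Module.Basis {w : List ℕ // Canon w} K (WSym K) :=
  Module.Basis.mk (v := fun w => Mword K w.1)
    (by
      rw [linearIndependent_iff]
      intro l hl
      ext w
      have := congrArg (evalWord w.1) hl
      rw [map_zero, Finsupp.linearCombination_apply, map_finsuppSum] at this
      simp only [map_smul, evalWord_apply, Mword_canon_apply, smul_eq_mul, mul_ite, mul_one,
        mul_zero] at this
      rw [Finsupp.sum_ite_eq'] at this
      simpa using this)
    (by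
      intro f _
      induction f using Mword_induction with
      | h w =>
        obtain ⟨v, hv, h⟩ := exists_canon w
        exact Mword_congr (K := K) h ▸ Submodule.subset_span ⟨⟨v, hv⟩, rfl⟩
      | h0 => exact Submodule.zero_mem _
      | hadd f g h1 h2 => exact Submodule.add_mem _ (h1 trivial) (h2 trivial)
      | hsmul r f h1 => exact Submodule.smul_mem _ _ (h1 trivial))

@[simp] theorem Mbasis_apply (w : {w : List ℕ // Canon w}) : Mbasis K w = Mword K w.1 := by
  simp [Mbasis]

theorem Mbasis_repr (f : WSym K) (w : {w : List ℕ // Canon w}) :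
    (Mbasis K).repr f w = f.1 w.1 := by
  have : (Mbasis K).coord w = evalWord w.1 :=
    (Mbasis K).ext fun u => by
      rw [evalWord_apply, Mbasis_apply, Mword_canon_apply, ← Mbasis_apply,
        Module.Basis.coord_apply, Module.Basis.repr_self, Finsupp.single_apply]
  exact LinearMap.congr_fun this f

theorem WSym_ext {f g : WSym K} (h : ∀ w, f.1 w = g.1 w) : f = g :=
  Subtype.ext (NCSeries.ext h)

/-! ### Products -/

/-- The left factor is homogeneous, so only the cut after `u.length` letters contributes to the
Cauchy product. -/
theorem Mword_mul_apply (u : List ℕ) (g : WSym K) (w : List ℕ) :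
    (Mword K u * g).1 w = (Mword K u).1 (w.take u.length) * g.1 (w.drop u.length) := by
  change ((Mword K u).1 * g.1) w = _
  rw [NCSeries.mul_apply]
  have h0 : ∀ v : List ℕ, v.length ≠ u.length → (Mword K u).1 v = 0 := fun v hv =>
    if_neg fun h => hv h.1.symm
  by_cases h : u.length ≤ w.length
  · refine Finset.sum_eq_single_of_mem _ (Finset.mem_range.2 (by omega)) fun i hi hne => ?_
    rw [Finset.mem_range] at hi
    rw [h0 _ (by simp; omega), zero_mul]
  · rw [h0 _ (by simp; omega), zero_mul]
    refine Finset.sum_eq_zero fun i hi => ?_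
    rw [h0 _ (by simp; omega), zero_mul]

/-! ### Uniqueness of coproducts -/

theorem tensorCoeff_tmul (u v : List ℕ) (f g : WSym K) :
    tensorCoeff u v (f ⊗ₜ g) = f.1 u * g.1 v := rfl

/-- Coefficients at pairs of canonical words are the coordinates in the tensor product basis.
Coproducts are therefore unique, and the tensor provided by `map_coproduct` can be replaced by any
explicitly computed one. -/
theorem tensorCoeff_ext {s t : WSym K ⊗[K] WSym K}
    (h : ∀ u v, tensorCoeff u v s = tensorCoeff u v t) : s = t := by
  refine ((Mbasis K).tensorProduct (Mbasis K)).ext_elem fun x => ?_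
  have : ((Mbasis K).tensorProduct (Mbasis K)).coord x = tensorCoeff x.1.1 x.2.1 := by
    refine ((Mbasis K).tensorProduct (Mbasis K)).ext fun y => ?_
    rw [Module.Basis.coord_apply, Module.Basis.repr_self, Module.Basis.tensorProduct_apply,
      tensorCoeff_tmul, Mbasis_apply, Mbasis_apply, Mword_canon_apply, Mword_canon_apply,
      Finsupp.single_apply]
    by_cases h1 : y.1 = x.1 <;> by_cases h2 : y.2 = x.2 <;> simp [Prod.ext_iff, h1, h2]
  have h' := h x.1.1 x.2.1
  rwa [← this] at h'

theorem IsCoproduct.eq {f : WSym K} {s t : WSym K ⊗[K] WSym K} (hs : IsCoproduct f s)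
    (ht : IsCoproduct f t) : s = t :=
  tensorCoeff_ext fun u v => (hs u v).trans (ht u v).symm

theorem IsCoproduct.add {f g : WSym K} {s t : WSym K ⊗[K] WSym K} (hs : IsCoproduct f s)
    (ht : IsCoproduct g t) : IsCoproduct (f + g) (s + t) := fun u v => by
  rw [map_add, hs, ht]
  exact (List.sum_map_add (f := fun w => f.1 w) (g := fun w => g.1 w)).symm

theorem IsCoproduct.smul (r : K) {f : WSym K} {s : WSym K ⊗[K] WSym K} (hs : IsCoproduct f s) :
    IsCoproduct (r • f) (r • s) := fun u v => by
  rw [map_smul, hs, smul_eq_mul]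
  exact (List.sum_map_mul_left _ (fun w => f.1 w) r).symm

theorem IsCoproduct.zero : IsCoproduct (0 : WSym K) 0 := fun u v => by
  rw [map_zero, doubling]
  exact (List.sum_eq_zero fun x hx => by
    obtain ⟨_, _, rfl⟩ := List.mem_map.1 hx
    rfl).symm

/-! ### Unshuffles -/

/-- All the ways to split a word into two complementary subwords. -/
def unshuffle {α : Type*} : List α → List (List α × List α)
  | [] => [([], [])]
  | a :: w => (unshuffle w).map (fun p => (a :: p.1, p.2)) ++
      (unshuffle w).map (fun p => (p.1, a :: p.2))

theorem length_of_mem_shuffle {α : Type*} (u v : List α) {w : List α}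
    (h : w ∈ shuffle u v) : w.length = u.length + v.length := by
  induction u, v using shuffle.induct generalizing w with
  | case1 v => simp [shuffle] at h; simp [h]
  | case2 a u => simp [shuffle] at h; simp [h]
  | case3 a u b v h1 h2 =>
    simp only [shuffle, List.mem_append, List.mem_map] at h
    rcases h with ⟨q, hq, rfl⟩ | ⟨q, hq, rfl⟩
    · simp [h1 hq]; omega
    · simp [h2 hq]; omega

theorem count_map_cons {α : Type*} [DecidableEq α] (a : α) (l : List (List α)) (b : α)
    (w : List α) : (l.map (List.cons a)).count (b :: w) = if a = b then l.count w else 0 := by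
  split_ifs with h
  · subst h
    exact List.count_map_of_injective _ _ (List.cons_injective) _
  · refine List.count_eq_zero.2 fun hm => ?_
    simp only [List.mem_map, List.cons.injEq] at hm
    obtain ⟨x, -, h', -⟩ := hm
    exact h h'

/-- The first letter of w goes to the left or to the right subword; this is the recursion defining
the shuffle, read backwards. -/
theorem count_unshuffle {α : Type*} [DecidableEq α] (w u v : List α) :
    (unshuffle w).count (u, v) = (shuffle u v).count w := by
  have key1 : ∀ (a b : α) (l : List (List α × List α)) (x y : List α),
      (l.map fun p => (a :: p.1, p.2)).count (b :: x, y) = if a = b then l.count (x, y) else 0 := by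
    intro a b l x y
    split_ifs with h
    · subst h
      exact List.count_map_of_injective l (fun p => (a :: p.1, p.2)) (fun p q h => by
        simp only [Prod.mk.injEq, List.cons.injEq, true_and] at h
        exact Prod.ext h.1 h.2) (x, y)
    · refine List.count_eq_zero.2 fun hm => ?_
      simp only [List.mem_map, Prod.mk.injEq, List.cons.injEq] at hm
      obtain ⟨_, -, ⟨h', -⟩, -⟩ := hm
      exact h h'
  have key2 : ∀ (a b : α) (l : List (List α × List α)) (x y : List α),
      (l.map fun p => (p.1, a :: p.2)).count (x, b :: y) = if a = b then l.count (x, y) else 0 := by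
    intro a b l x y
    split_ifs with h
    · subst h
      exact List.count_map_of_injective l (fun p => (p.1, a :: p.2)) (fun p q h => by
        simp only [Prod.mk.injEq, List.cons.injEq, true_and] at h
        exact Prod.ext h.1 h.2) (x, y)
    · refine List.count_eq_zero.2 fun hm => ?_
      simp only [List.mem_map, Prod.mk.injEq, List.cons.injEq] at hm
      obtain ⟨_, -, -, h', -⟩ := hm
      exact h h'
  have key3 : ∀ (a : α) (l : List (List α × List α)) (y : List α),
      (l.map fun p => (a :: p.1, p.2)).count ([], y) = 0 := by
    intro a l y
    refine List.count_eq_zero.2 fun hm => ?_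
    simp at hm
  have key4 : ∀ (a : α) (l : List (List α × List α)) (x : List α),
      (l.map fun p => (p.1, a :: p.2)).count (x, []) = 0 := by
    intro a l y
    refine List.count_eq_zero.2 fun hm => ?_
    simp at hm
  induction w generalizing u v with
  | nil =>
    obtain _ | ⟨a, u⟩ := u <;> obtain _ | ⟨b, v⟩ := v <;>
      simp [unshuffle, shuffle]
    rw [List.count_eq_zero.2, List.count_eq_zero.2] <;> simp
  | cons c w ih =>
    rw [unshuffle, List.count_append]
    obtain _ | ⟨a, u⟩ := u <;> obtain _ | ⟨b, v⟩ := v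
    · rw [key3, key4]
      simp [shuffle]
    · rw [key3, key2, ih]
      simp only [shuffle, List.count_singleton, beq_iff_eq, List.cons.injEq]
      by_cases h : c = b <;> simp [h, eq_comm]
    · rw [key4, key1, ih]
      obtain _ | ⟨a', u⟩ := u <;>
      simp only [shuffle, List.count_singleton, beq_iff_eq, List.cons.injEq] <;>
      by_cases h : c = a <;> simp [h, eq_comm]
    · rw [key1, key2, ih, ih, shuffle, List.count_append, count_map_cons, count_map_cons]
      simp only [eq_comm]

end BinaryShuffle
end

/-! ### From set partitions to words; the preimages of the X in WSym -/

open scoped TensorProduct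
noncomputable section
namespace BinaryShuffle

variable {K : Type*} [Field K]

/-! ### The two compositions of a set partition, read on words -/

/-- The positions of the last occurrences of the letters, the first position being `k`. -/
def lastPos (k : ℕ) : List ℕ → List ℕ
  | [] => []
  | a :: w => if a ∈ w then lastPos (k + 1) w else k :: lastPos (k + 1) w

theorem mem_lastPos {k : ℕ} {w : List ℕ} {x : ℕ} :
    x ∈ lastPos k w ↔ ∃ i, x = k + i ∧ ∃ a, w[i]? = some a ∧ ∀ j, i < j → w[j]? ≠ some a := by
  induction w generalizing k with
  | nil => simp [lastPos]
  | cons b w ih =>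
    have h0 : (∃ i, x = k + i ∧ ∃ a, (b :: w)[i]? = some a ∧ ∀ j, i < j → (b :: w)[j]? ≠ some a) ↔
        (x = k ∧ b ∉ w) ∨ x ∈ lastPos (k + 1) w := by
      rw [ih]
      constructor
      · rintro ⟨_ | i, rfl, a, ha, h⟩
        · simp only [List.getElem?_cons_zero, Option.some.injEq] at ha
          subst ha
          refine Or.inl ⟨rfl, fun hb => ?_⟩
          obtain ⟨j, hj⟩ := List.mem_iff_getElem?.1 hb
          exact h (j + 1) (Nat.succ_pos j) (by simpa using hj)
        · refine Or.inr ⟨i, by omega, a, by simpa using ha, fun j hj => ?_⟩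
          simpa using h (j + 1) (by omega)
      · rintro (⟨rfl, hb⟩ | ⟨i, rfl, a, ha, h⟩)
        · refine ⟨0, rfl, b, rfl, ?_⟩
          rintro (_ | j) hj h
          · omega
          · exact hb (List.mem_iff_getElem?.2 ⟨j, by simpa using h⟩)
        · refine ⟨i + 1, by omega, a, by simpa using ha, ?_⟩
          rintro (_ | j) hj
          · omega
          · simpa using h j (by omega)
    rw [h0, lastPos]
    split_ifs with hb
    · simp [hb]
    · simp [hb]

theorem le_of_mem_lastPos {k : ℕ} {w : List ℕ} {x : ℕ} (h : x ∈ lastPos k w) : k ≤ x := by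
  obtain ⟨i, rfl, -⟩ := mem_lastPos.1 h
  omega

theorem pairwise_lastPos (k : ℕ) (w : List ℕ) : (lastPos k w).Pairwise (· < ·) := by
  induction w generalizing k with
  | nil => simp [lastPos]
  | cons b w ih =>
    rw [lastPos]
    split_ifs with hb
    · exact ih _
    · exact List.pairwise_cons.2 ⟨fun x hx => le_of_mem_lastPos hx, ih _⟩

theorem map_lastPos (k : ℕ) (w : List ℕ) (g : ℕ → ℕ)
    (hg : ∀ i a, w[i]? = some a → g (k + i) = a) : (lastPos k w).map g = w.dedup := by
  induction w generalizing k with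
  | nil => simp [lastPos]
  | cons b w ih =>
    have h := ih (k + 1) fun i a h => by
      have := hg (i + 1) a (by simpa using h)
      rwa [show k + 1 + i = k + (i + 1) by omega]
    rw [lastPos]
    split_ifs with hb
    · rw [List.dedup_cons_of_mem hb, h]
    · rw [List.dedup_cons_of_notMem hb, List.map_cons, h, show g k = b from hg 0 b rfl]

/-- Here k letters have been read and the most recent last occurrence was at position m, counted
from 1, so `k - m` zeros are still pending when w begins. -/
theorem binWord_diff_lastPos (k m : ℕ) (hm : m ≤ k) (w : List ℕ) (hw : w ≠ []) :
    binWord (List.zipWith (fun x y => x - y) (lastPos (k + 1) w) (m :: lastPos (k + 1) w)) =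
      List.replicate (k - m) false ++ lastBits w := by
  induction w generalizing k m with
  | nil => exact absurd rfl hw
  | cons a w ih =>
    rw [lastPos, lastBits]
    split_ifs with ha
    · rw [ih (k + 1) m (by omega) (List.ne_nil_of_mem ha), Nat.succ_sub hm, List.replicate_succ']
      simp [ha]
    · rw [List.zipWith_cons_cons, binWord_cons, decide_eq_true ha]
      congr 2
      · omega
      · by_cases hw' : w = []
        · subst hw'
          rfl
        · simpa using ih (k + 1) (k + 1) le_rfl hw'

theorem pos_of_mem_diff_lastPos (k m : ℕ) (hm : m ≤ k) (w : List ℕ) :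
    ∀ i ∈ List.zipWith (fun x y => x - y) (lastPos (k + 1) w) (m :: lastPos (k + 1) w), 0 < i := by
  induction w generalizing k m with
  | nil => simp [lastPos]
  | cons a w ih =>
    rw [lastPos]
    split_ifs with ha
    · exact ih (k + 1) m (by omega)
    · intro i hi
      rw [List.zipWith_cons_cons, List.mem_cons] at hi
      rcases hi with rfl | hi
      · omega
      · exact ih (k + 1) (k + 1) le_rfl i hi

theorem orbitSum_ne_zero_iff {n : ℕ} {π : SetPartition n} {w : List ℕ} :
    orbitSum K π w ≠ 0 ↔ w.length = n ∧
      ∀ i j : Fin n, w[(i : ℕ)]? = w[(j : ℕ)]? ↔ π.part i = π.part j := by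
  unfold orbitSum
  split_ifs with h
  · simp only [ne_eq, one_ne_zero, not_false_eq_true, true_iff]; exact h
  · simp only [ne_eq, not_true_eq_false, false_iff]; exact h

/-- Both lists are strictly increasing, so it suffices that they have the same members: the maximum
of a block is the last position of its letter. -/
theorem sort_maxima {n : ℕ} {π : SetPartition n} {w : List ℕ} (h : orbitSum K π w ≠ 0) :
    ((maxima π).sort (· ≤ ·)).map Fin.val = lastPos 0 w := by
  obtain ⟨rfl, h⟩ := orbitSum_ne_zero_iff.1 h
  have h1 : (((maxima π).sort (· ≤ ·)).map Fin.val).Pairwise (· < ·) :=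
    List.pairwise_map.2 (Finset.sortedLT_sort (maxima π)).pairwise
  refine List.Perm.eq_of_pairwise (le := (· < ·)) (fun a b _ _ h1 h2 => absurd h1 (lt_asymm h2)) h1
    (pairwise_lastPos 0 w) ((List.perm_ext_iff_of_nodup (h1.imp (fun h => ne_of_lt h))
      ((pairwise_lastPos 0 w).imp (fun h => ne_of_lt h))).2 fun x => ?_)
  rw [mem_lastPos]
  simp only [List.mem_map, Finset.mem_sort, maxima, Finset.mem_filter, Finset.mem_univ, true_and,
    zero_add]
  constructor
  · rintro ⟨i, hi, rfl⟩
    refine ⟨i, rfl, w[i], List.getElem?_eq_getElem i.2, fun j hij hj => ?_⟩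
    obtain ⟨hj', hj⟩ := List.getElem?_eq_some_iff.1 hj
    have := (h ⟨j, hj'⟩ i).1 (by
      rw [List.getElem?_eq_getElem hj', List.getElem?_eq_getElem i.2]
      simpa using hj)
    have := hi ⟨j, hj'⟩ (this ▸ π.mem_part (Finset.mem_univ _))
    exact absurd (show j ≤ i from this) (by omega)
  · rintro ⟨i, rfl, a, ha, hlast⟩
    obtain ⟨hi, rfl⟩ := List.getElem?_eq_some_iff.1 ha
    refine ⟨⟨x, hi⟩, fun j hj => ?_, rfl⟩
    rw [π.mem_part_iff_part_eq_part (Finset.mem_univ _) (Finset.mem_univ _)] at hj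
    by_contra hlt
    rw [not_le] at hlt
    exact hlast j hlt (((h j ⟨x, hi⟩).2 hj).trans ha)

theorem card_part {n : ℕ} {π : SetPartition n} {w : List ℕ} (h : orbitSum K π w ≠ 0) (i : Fin n) {a : ℕ}
    (ha : w[(i : ℕ)]? = some a) : (π.part i).card = w.count a := by
  obtain ⟨rfl, h⟩ := orbitSum_ne_zero_iff.1 h
  have h1 : π.part i = Finset.univ.filter fun j : Fin w.length => a = w.get j := by
    ext j
    rw [π.mem_part_iff_part_eq_part (Finset.mem_univ _) (Finset.mem_univ _), ← h, ha,
      List.getElem?_eq_getElem j.2]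
    simp [eq_comm]
  have h2 : (w : Multiset ℕ) = (Finset.univ : Finset (Fin w.length)).val.map w.get := by
    rw [Fin.univ_val_map, List.ofFn_get]
  rw [h1, ← Multiset.coe_count, h2, Multiset.count_map]
  rfl

theorem sizeComp_eq {n : ℕ} {π : SetPartition n} {w : List ℕ} (h : orbitSum K π w ≠ 0) :
    sizeComp π = content w := by
  have h0 := h
  obtain ⟨rfl, -⟩ := orbitSum_ne_zero_iff.1 h
  have h1 := map_lastPos 0 w (fun x => w.getD x 0) (fun i a ha => by simp [ha])
  rw [← sort_maxima h0, List.map_map] at h1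
  rw [content, ← h1, List.map_map, sizeComp]
  refine List.map_congr_left fun i _ => card_part h0 i ?_
  simp

theorem maximaList_eq {n : ℕ} {π : SetPartition n} {w : List ℕ} (h : orbitSum K π w ≠ 0) :
    maximaList π = lastPos 1 w := by
  have key : ∀ (v : List ℕ) (k : ℕ), (lastPos k v).map (· + 1) = lastPos (k + 1) v := by
    intro v
    induction v with
    | nil => intro k; rfl
    | cons a v ih =>
      intro k
      rw [lastPos, lastPos]
      split_ifs <;> simp [ih]
  rw [← key w 0, ← sort_maxima h, List.map_map, maximaList]
  simp [Function.comp_def, ← List.map_eq_flatMap]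

theorem binWord_maxComp {n : ℕ} {π : SetPartition n} {w : List ℕ} (h : orbitSum K π w ≠ 0) :
    binWord (maxComp π) = lastBits w := by
  rw [maxComp, maximaList_eq h]
  by_cases hw : w = []
  · subst hw
    rfl
  · simpa using binWord_diff_lastPos 0 0 le_rfl w hw

theorem pos_of_mem_maxComp {n : ℕ} (π : SetPartition n) : ∀ i ∈ maxComp π, 0 < i := by
  -- The claim is purely combinatorial; ℚ only supplies some field in which to say that the word has
  -- pattern π.
  rw [maxComp, maximaList_eq (K := ℚ) (w := wordOf π) (by rw [wordOf_spec]; exact one_ne_zero)]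
  exact pos_of_mem_diff_lastPos 0 0 le_rfl _

/-- The composition `K(π)`. -/
def sizeComposition {n : ℕ} (π : SetPartition n) : Composition n where
  blocks := sizeComp π
  blocks_pos {i} hi := by
    rw [sizeComp_eq (K := ℚ) (w := wordOf π) (by rw [wordOf_spec]; exact one_ne_zero)] at hi
    exact pos_of_mem_content hi
  blocks_sum := by
    rw [sizeComp_eq (K := ℚ) (w := wordOf π) (by rw [wordOf_spec]; exact one_ne_zero),
      sum_content, length_wordOf]

theorem exists_sizeComp (L : List ℕ) (hL : ∀ i ∈ L, 0 < i) :
    ∃ w, content w = L ∧ lastBits w = binWord L :=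
  ⟨intervalWord 0 L, content_intervalWord 0 hL, lastBits_intervalWord 0 hL⟩

/-! ### Sums over the partitions with given maxima -/

/-- The sum of the words whose last occurrences are at the ones of `b`. -/
def lastSum (K : Type*) [Field K] (b : List Bool) : WSym K :=
  ⟨fun w => if lastBits w = b then 1 else 0, mem_WSymSpan_iff.2 ⟨⟨b.length + 1, fun v hv =>
    if_neg fun h => by have := congrArg List.length h; rw [length_lastBits] at this; omega⟩,
    fun u v h => by rw [h.lastBits_eq]⟩⟩

theorem lastSum_apply (b : List Bool) (w : List ℕ) :
    (lastSum K b).1 w = if lastBits w = b then 1 else 0 := rfl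

theorem lastSum_eq_zero {b : List Bool} (hb : b.getLast? = some false) : lastSum K b = 0 := by
  refine WSym_ext fun w => if_neg ?_
  rintro rfl
  exact getLast?_lastBits w hb

theorem M_apply_eq {n : ℕ} (π : SetPartition n) (w : List ℕ) (h : orbitSum K π w ≠ 0) :
    (M K π).1 w = 1 := by
  change orbitSum K π w = 1
  have : orbitSum K π w = 0 ∨ orbitSum K π w = 1 := by
    unfold orbitSum
    split_ifs <;> simp
  exact this.resolve_left h

/-- Every word has exactly one pattern, and its last occurrences determine $C(\pi)$, so exactly one
term on the right is nonzero at a word counted on the left. -/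
theorem lastSum_eq_sum {n : ℕ} (J : Composition n) :
    lastSum K (binWord J.blocks) =
      ∑ π : SetPartition n with maxComp π = J.blocks, M K π := by
  refine WSym_ext fun w => ?_
  rw [← evalWord_apply w (∑ _ ∈ _, _), map_sum, lastSum_apply]
  simp only [evalWord_apply]
  have hlen : (binWord J.blocks).length = n := by
    rw [length_binWord fun i hi => J.blocks_pos hi, J.blocks_sum]
  split_ifs with h
  · have hw : w.length = n := by rw [← length_lastBits, h, hlen]
    subst hw
    obtain ⟨π, hπ, -⟩ := exists_M_eq_Mword (K := K) w
    have hne : orbitSum K π w ≠ 0 := by rw [hπ]; exact one_ne_zero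
    rw [Finset.sum_eq_single π]
    · exact (M_apply_eq π w hne).symm
    · intro ρ _ hρ
      by_contra h0
      exact hρ (eq_of_orbitSum h0 hne)
    · intro hmem
      refine absurd ?_ hmem
      rw [Finset.mem_filter]
      refine ⟨Finset.mem_univ _, binWord_injective (pos_of_mem_maxComp π)
        (fun i hi => J.blocks_pos hi) ?_⟩
      rw [binWord_maxComp hne, h]
  · refine (Finset.sum_eq_zero fun π hπ => ?_).symm
    by_contra h0
    rw [Finset.mem_filter] at hπ
    exact h (by rw [← binWord_maxComp h0, hπ.2])

/-- With no common letters, whether a letter occurs again later in a shuffle depends only on the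
word it comes from. This is where the binary shuffle enters. -/
theorem map_lastBits_shuffle (u v : List ℕ) (huv : ∀ a ∈ u, a ∉ v) :
    (shuffle u v).map lastBits = shuffle (lastBits u) (lastBits v) := by
  have mem : ∀ (u v w : List ℕ), w ∈ shuffle u v → ∀ a, a ∈ w ↔ a ∈ u ∨ a ∈ v := by
    intro u v
    induction u, v using shuffle.induct with
    | case1 v => intro w hw; simp [shuffle] at hw; simp [hw]
    | case2 a u => intro w hw; simp [shuffle] at hw; simp [hw]
    | case3 a u b v h1 h2 =>
      intro w hw x
      simp only [shuffle, List.mem_append, List.mem_map] at hw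
      rcases hw with ⟨q, hq, rfl⟩ | ⟨q, hq, rfl⟩
      · simp [h1 q hq x]; tauto
      · simp [h2 q hq x]; tauto
  induction u, v using shuffle.induct with
  | case1 v => simp [shuffle, lastBits]
  | case2 a u => simp [shuffle, lastBits]
  | case3 a u b v h1 h2 =>
    have h1 := h1 fun x hx => huv x (by simp [hx])
    have h2 := h2 fun x hx hv => huv x hx (by simp [hv])
    rw [shuffle, List.map_append, List.map_map, List.map_map, lastBits, lastBits, shuffle]
    rw [lastBits] at h1 h2
    rw [← h1, ← h2, List.map_map, List.map_map]
    congr 1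
    · refine List.map_congr_left fun w hw => ?_
      have : a ∈ w ↔ a ∈ u := by
        rw [mem _ _ _ hw, or_iff_left (huv a (by simp))]
      simp [lastBits, this]
    · refine List.map_congr_left fun w hw => ?_
      have : b ∈ w ↔ b ∈ v := by
        rw [mem _ _ _ hw, or_iff_right fun h => huv b h (by simp)]
      simp [lastBits, this]

theorem sum_map_ite_count {α : Type*} [BEq α] [LawfulBEq α] [DecidableEq α] (l : List α) (a : α) :
    (l.map fun x => if x = a then (1 : K) else 0).sum = l.count a := by
  induction l with
  | nil => simp
  | cons b l ih =>
    rw [List.map_cons, List.sum_cons, ih, List.count_cons]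
    by_cases h : b = a <;> simp [h, add_comm]

theorem two_mul_injective : Function.Injective fun x : ℕ => 2 * x := fun a b h => by
  simp only at h; omega

theorem two_mul_add_one_injective : Function.Injective fun x : ℕ => 2 * x + 1 := fun a b h => by
  simp only at h; omega

theorem isCoproduct_lastSum (b : List Bool) :
    IsCoproduct (lastSum K b)
      ((unshuffle b).map fun p => lastSum K p.1 ⊗ₜ[K] lastSum K p.2).sum := fun u v => by
  have h1 : doubling (lastSum K b).1 u v =
      (((shuffle (u.map fun x => 2 * x) (v.map fun x => 2 * x + 1)).map lastBits).map
        fun x => if x = b then (1 : K) else 0).sum := by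
    rw [List.map_map]
    rfl
  rw [h1, map_lastBits_shuffle, sum_map_ite_count, ← count_unshuffle,
    lastBits_map u two_mul_injective, lastBits_map v two_mul_add_one_injective, map_list_sum,
    List.map_map, ← sum_map_ite_count]
  · congr 1
    refine List.map_congr_left fun p _ => ?_
    rw [Function.comp_apply, tensorCoeff_tmul, lastSum_apply, lastSum_apply]
    by_cases h1 : p.1 = lastBits u <;> by_cases h2 : p.2 = lastBits v <;>
      simp [Prod.ext_iff, h1, h2, eq_comm]
  · intro a ha ha'
    simp only [List.mem_map] at ha ha'
    obtain ⟨x, -, rfl⟩ := ha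
    obtain ⟨y, -, hy⟩ := ha'
    omega

end BinaryShuffle
end

/-! ### Linear algebra by degree, and the duality between NSym and QSym -/

open scoped TensorProduct
noncomputable section
namespace BinaryShuffle

/-! ### Homogeneous spanning families -/

/-- In each degree the family has as many members as a basis. Projecting the spanning property to
degree n gives a surjective endomorphism of the finite-dimensional space `ι n → K`, which is then
injective. -/
theorem linearIndependent_of_homogeneous {K E : Type*} [Field K] [AddCommGroup E] [Module K E]
    {ι : ℕ → Type*} [∀ n, Fintype (ι n)] (b : Module.Basis (Σ n, ι n) K E) (v : (Σ n, ι n) → E)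
    (hv : ∀ n i, v ⟨n, i⟩ ∈ Submodule.span K (Set.range fun j => b ⟨n, j⟩))
    (hs : ⊤ ≤ Submodule.span K (Set.range v)) : LinearIndependent K v := by
  classical
  let P : ∀ n, E →ₗ[K] (ι n → K) := fun n => LinearMap.pi fun j => b.coord ⟨n, j⟩
  have hP : ∀ n m i, m ≠ n → P n (v ⟨m, i⟩) = 0 := by
    intro n m i hmn
    have hle : Submodule.span K (Set.range fun j => b ⟨m, j⟩) ≤ LinearMap.ker (P n) := by
      rw [Submodule.span_le]
      rintro _ ⟨j, rfl⟩
      refine funext fun k => ?_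
      have : (⟨m, j⟩ : Σ n, ι n) ≠ ⟨n, k⟩ := fun h => hmn (congrArg Sigma.fst h)
      simp [P, this]
    exact hle (hv m i)
  let R : ∀ n, ((Σ n, ι n) →₀ K) →ₗ[K] (ι n → K) := fun n =>
    LinearMap.pi fun i => Finsupp.lapply ⟨n, i⟩
  let T : ∀ n, (ι n → K) →ₗ[K] (ι n → K) := fun n =>
    Fintype.linearCombination K fun i => P n (v ⟨n, i⟩)
  -- The degree n part of a combination only involves its degree n coefficients, since members of
  -- other degrees project to 0.
  have hT : ∀ n, T n ∘ₗ R n = P n ∘ₗ Finsupp.linearCombination K v := by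
    intro n
    refine Finsupp.lhom_ext fun ⟨m, i⟩ r => ?_
    rw [LinearMap.comp_apply, LinearMap.comp_apply, Finsupp.linearCombination_single, map_smul]
    by_cases hmn : m = n
    · subst hmn
      rw [Fintype.linearCombination_apply, Finset.sum_eq_single i]
      · simp [R]
      · intro j _ hj
        have : (⟨m, i⟩ : Σ n, ι n) ≠ ⟨m, j⟩ := fun h => hj (by simpa [eq_comm] using h)
        simp [R, this]
      · simp
    · rw [hP n m i hmn, smul_zero]
      have : R n (Finsupp.single ⟨m, i⟩ r) = 0 := funext fun k => by
        have : (⟨m, i⟩ : Σ n, ι n) ≠ ⟨n, k⟩ := fun h => hmn (congrArg Sigma.fst h)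
        simp [R, this]
      rw [this, map_zero]
  have hinj : ∀ n, Function.Injective (T n) := by
    intro n
    rw [LinearMap.injective_iff_surjective]
    intro y
    obtain ⟨l, hl⟩ := (Finsupp.mem_span_range_iff_exists_finsupp).1
      (hs (show ∑ j, y j • b ⟨n, j⟩ ∈ ⊤ from trivial))
    refine ⟨R n l, ?_⟩
    rw [← LinearMap.comp_apply, hT, LinearMap.comp_apply, Finsupp.linearCombination_apply, hl]
    refine funext fun k => ?_
    simp [P, Finsupp.single_apply]
  rw [linearIndependent_iff]
  intro l hl
  ext ⟨n, i⟩
  have h0 : T n (R n l) = T n 0 := by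
    rw [← LinearMap.comp_apply, hT, LinearMap.comp_apply, hl, map_zero, map_zero]
  exact congrFun (hinj n h0) i

variable (K : Type*) [Field K]

/-! ### Noncommutative symmetric functions -/

@[simp] theorem S_zero : S K 0 = 1 := by simp [S]

theorem S_coe (n : ℕ+) : S K n = FreeAlgebra.ι K n := by
  exact dif_pos n.2

theorem Sprod_nil : Sprod K [] = 1 := rfl

theorem Sprod_cons (i : ℕ) (I : List ℕ) : Sprod K (i :: I) = S K i * Sprod K I := by
  simp [Sprod]

theorem Sprod_append (I J : List ℕ) : Sprod K (I ++ J) = Sprod K I * Sprod K J := by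
  simp [Sprod]

theorem Sprod_filter (I : List ℕ) : Sprod K (I.filter (0 < ·)) = Sprod K I := by
  induction I with
  | nil => rfl
  | cons i I ih =>
    obtain rfl | hi := Nat.eq_zero_or_pos i
    · rw [List.filter_cons_of_neg (by simp), ih, Sprod_cons, S_zero, one_mul]
    · rw [List.filter_cons_of_pos (by simpa using hi), Sprod_cons, Sprod_cons, ih]

theorem basisFreeMonoid_eq_Sprod (J : FreeMonoid ℕ+) :
    FreeAlgebra.basisFreeMonoid K ℕ+ J = Sprod K (J.toList.map fun j : ℕ+ => (j : ℕ)) := by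
  have h1 : FreeAlgebra.basisFreeMonoid K ℕ+ J =
      FreeAlgebra.equivMonoidAlgebraFreeMonoid.symm (MonoidAlgebra.single J 1) := rfl
  have h2 : FreeAlgebra.equivMonoidAlgebraFreeMonoid.symm (MonoidAlgebra.single J (1 : K)) =
      (FreeMonoid.lift (FreeAlgebra.ι K)) J := by
    change (MonoidAlgebra.lift K _ _ (FreeMonoid.lift (FreeAlgebra.ι K))) _ = _
    rw [MonoidAlgebra.lift_single, one_smul]
  rw [h1, h2, FreeMonoid.lift_apply, Sprod, List.map_map]
  congr 1
  refine List.map_congr_left fun j _ => (S_coe K j).symm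

/-- A list of positive integers as a list over `ℕ+`. -/
def toPNatList (L : List ℕ) : List ℕ+ := L.map fun i => Nat.succPNat (i - 1)

theorem map_coe_toPNatList {L : List ℕ} (hL : ∀ i ∈ L, 0 < i) :
    (toPNatList L).map (fun j : ℕ+ => (j : ℕ)) = L := by
  rw [toPNatList, List.map_map]
  refine map_eq_self (s := (fun j : ℕ+ => (j : ℕ)) ∘ fun i => Nat.succPNat (i - 1)) fun i hi => ?_
  have := hL i hi
  simp only [Function.comp_apply, Nat.succPNat_coe]
  omega

theorem toPNatList_map_coe (L : List ℕ+) : toPNatList (L.map fun j : ℕ+ => (j : ℕ)) = L := by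
  rw [toPNatList, List.map_map]
  refine (List.map_congr_left fun j _ => ?_).trans (List.map_id L)
  refine PNat.eq ?_
  have := j.pos
  simp only [Function.comp_apply, Nat.succPNat_coe, id]
  omega

theorem composition_ext {I J : Σ n, Composition n} (h : I.2.blocks = J.2.blocks) : I = J := by
  obtain ⟨_, L, hL, rfl⟩ := I
  obtain ⟨_, L', hL', rfl⟩ := J
  simp only at h
  subst h
  rfl

/-- Compositions are words over the positive integers. -/
def freeMonoidEquivComposition : FreeMonoid ℕ+ ≃ Σ n, Composition n where
  toFun J := ⟨(J.toList.map fun j : ℕ+ => (j : ℕ)).sum, J.toList.map fun j : ℕ+ => (j : ℕ),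
    fun {i} hi => by
      obtain ⟨j, -, rfl⟩ := List.mem_map.1 hi
      exact j.2, rfl⟩
  invFun I := FreeMonoid.ofList (toPNatList I.2.blocks)
  left_inv J := toPNatList_map_coe J.toList
  right_inv I := composition_ext (map_coe_toPNatList fun i hi => I.2.blocks_pos hi)

/-- The basis `S^I`. -/
def Sbasis : Module.Basis (Σ n, Composition n) K (NSym K) :=
  (FreeAlgebra.basisFreeMonoid K ℕ+).reindex freeMonoidEquivComposition

theorem Sbasis_apply (I : Σ n, Composition n) : Sbasis K I = Sprod K I.2.blocks := by
  rw [Sbasis, Module.Basis.reindex_apply, basisFreeMonoid_eq_Sprod]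
  congr 1
  exact congrArg (fun J : Σ n, Composition n => J.2.blocks)
    (freeMonoidEquivComposition.apply_symm_apply I)

theorem nsymDegree_eq (n : ℕ) :
    nsymDegree K n = Submodule.span K (Set.range fun I : Composition n => Sbasis K ⟨n, I⟩) := by
  simp only [Sbasis_apply]
  rfl

variable {K}

theorem pairing_Sprod (F : MvPowerSeries ℕ K) {L : List ℕ} (hL : ∀ i ∈ L, 0 < i) :
    pairing F (Sprod K L) = MvPowerSeries.coeff L.toFinsupp F := by
  have h := map_coe_toPNatList hL
  have h' := basisFreeMonoid_eq_Sprod K (FreeMonoid.ofList (toPNatList L))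
  rw [FreeMonoid.toList_ofList, h] at h'
  rw [← h', pairing, Module.Basis.constr_basis, FreeMonoid.toList_ofList, h]

/-- The list of the nonzero exponents of a monomial. -/
def exponents (m : ℕ →₀ ℕ) : List ℕ := (m.support.sort (· ≤ ·)).map m

theorem pos_of_mem_exponents {m : ℕ →₀ ℕ} {i : ℕ} (h : i ∈ exponents m) : 0 < i := by
  obtain ⟨j, hj, rfl⟩ := List.mem_map.1 h
  rw [Finset.mem_sort, Finsupp.mem_support_iff] at hj
  exact Nat.pos_of_ne_zero hj

theorem exponents_add_single {m : ℕ →₀ ℕ} {k c : ℕ} (hk : ∀ i ∈ m.support, i < k) (hc : c ≠ 0) :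
    exponents (m + Finsupp.single k c) = exponents m ++ [c] := by
  have hmk : m k = 0 := Finsupp.notMem_support_iff.1 fun h => lt_irrefl _ (hk k h)
  have hs : ((m + Finsupp.single k c).support.sort (· ≤ ·)) = m.support.sort (· ≤ ·) ++ [k] := by
    refine List.Perm.eq_of_pairwise (le := (· ≤ ·)) (fun a b _ _ h1 h2 => le_antisymm h1 h2)
      (Finset.pairwise_sort _ _) (List.pairwise_append.2 ⟨Finset.pairwise_sort _ _,
        List.pairwise_singleton _ _, fun a ha b hb => ?_⟩)
      ((List.perm_ext_iff_of_nodup (Finset.sort_nodup _ _) (List.nodup_append.2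
        ⟨Finset.sort_nodup _ _, List.nodup_singleton _, fun a ha b hb => ?_⟩)).2 fun x => ?_)
    · rw [Finset.mem_sort] at ha
      rw [List.mem_singleton] at hb
      exact hb ▸ (hk a ha).le
    · rw [Finset.mem_sort] at ha
      rw [List.mem_singleton] at hb
      exact hb ▸ (hk a ha).ne
    · simp only [Finset.mem_sort, Finsupp.mem_support_iff, Finsupp.add_apply, List.mem_append,
        List.mem_singleton, Finsupp.single_apply]
      by_cases hx : k = x
      · subst hx; simp [hc]
      · simp [hx, Ne.symm hx]
  rw [exponents, hs, List.map_append, exponents]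
  congr 1
  · refine List.map_congr_left fun a ha => ?_
    rw [Finset.mem_sort] at ha
    simp [(hk a ha).ne']
  · simp [hmk]

theorem Sprod_exponents_add_single {m : ℕ →₀ ℕ} {k : ℕ} (c : ℕ) (hk : ∀ i ∈ m.support, i < k) :
    Sprod K (exponents (m + Finsupp.single k c)) = Sprod K (exponents m) * S K c := by
  by_cases hc : c = 0
  · subst hc; simp
  · rw [exponents_add_single hk hc, Sprod_append, Sprod_cons, Sprod_nil, mul_one]

theorem exponents_toFinsupp {L : List ℕ} (hL : ∀ i ∈ L, 0 < i) : exponents L.toFinsupp = L := by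
  induction L using List.reverseRecOn with
  | nil => simp [exponents]
  | append_singleton L a ih =>
    rw [List.toFinsupp_concat_eq_toFinsupp_add_single, exponents_add_single,
      ih fun i hi => hL i (by simp [hi])]
    · intro i hi
      rw [Finsupp.mem_support_iff, List.toFinsupp_apply] at hi
      by_contra h
      exact hi (List.getD_eq_default _ _ (by omega))
    · exact (hL a (by simp)).ne'

theorem nsymCoproduct_S (n : ℕ) :
    nsymCoproduct K (S K n) = ∑ p ∈ Finset.HasAntidiagonal.antidiagonal n, S K p.1 ⊗ₜ[K] S K p.2 := by
  rw [Finset.Nat.sum_antidiagonal_eq_sum_range_succ fun i j => S K i ⊗ₜ[K] S K j]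
  obtain rfl | hn := Nat.eq_zero_or_pos n
  · simp [Algebra.TensorProduct.one_def]
  · lift n to ℕ+ using hn
    rw [S_coe, nsymCoproduct, FreeAlgebra.lift_ι_apply]

/-- The variable k does not occur in m, so splitting the monomial means splitting m and the exponent
c independently. -/
theorem sum_antidiagonal_add_single {E : Type*} [AddCommMonoid E] {m : ℕ →₀ ℕ} {k : ℕ} (c : ℕ)
    (hk : m k = 0) (f : (ℕ →₀ ℕ) → (ℕ →₀ ℕ) → E) :
    ∑ p ∈ Finset.HasAntidiagonal.antidiagonal (m + Finsupp.single k c), f p.1 p.2 =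
      ∑ p ∈ Finset.HasAntidiagonal.antidiagonal m, ∑ q ∈ Finset.HasAntidiagonal.antidiagonal c,
        f (p.1 + Finsupp.single k q.1) (p.2 + Finsupp.single k q.2) := by
  rw [← Finset.sum_product']
  symm
  refine Finset.sum_bij' (fun x _ => (x.1.1 + Finsupp.single k x.2.1,
      x.1.2 + Finsupp.single k x.2.2))
    (fun p _ => ((p.1.erase k, p.2.erase k), (p.1 k, p.2 k))) ?_ ?_ ?_ ?_ ?_
  · rintro ⟨⟨a, b⟩, i, j⟩ h
    simp only [Finset.mem_product, Finset.HasAntidiagonal.mem_antidiagonal] at h ⊢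
    rw [← h.1, ← h.2, Finsupp.single_add]
    abel
  · rintro ⟨a, b⟩ h
    simp only [Finset.mem_product, Finset.HasAntidiagonal.mem_antidiagonal] at h ⊢
    constructor
    · ext x
      have := DFunLike.congr_fun h x
      by_cases hx : x = k
      · subst hx; simp [hk]
      · simpa [hx, Finsupp.erase_ne hx] using this
    · have := DFunLike.congr_fun h k
      simpa [hk] using this
  · rintro ⟨⟨a, b⟩, i, j⟩ h
    simp only [Finset.mem_product, Finset.HasAntidiagonal.mem_antidiagonal] at h ⊢
    have hab := DFunLike.congr_fun h.1 k
    simp only [Finsupp.add_apply, hk, Nat.add_eq_zero_iff] at hab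
    have he : ∀ (f : ℕ →₀ ℕ) (r : ℕ), f k = 0 → (f + Finsupp.single k r).erase k = f := by
      intro f r hf
      ext x
      by_cases hx : x = k
      · subst hx; simp [hf]
      · simp [Finsupp.erase_ne hx]
    simp [he, hab.1, hab.2]
  · rintro ⟨a, b⟩ h
    simp [Finsupp.erase_add_single]
  · rintro ⟨⟨a, b⟩, i, j⟩ h
    rfl

/-- Indexing by monomials instead of compositions makes the terms of the coproduct those of a power
series product. Zero exponents that arise in a splitting are harmless because $S_0=1$. -/
theorem nsymCoproduct_Sprod_exponents (m : ℕ →₀ ℕ) :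
    nsymCoproduct K (Sprod K (exponents m)) =
      ∑ p ∈ Finset.HasAntidiagonal.antidiagonal m, Sprod K (exponents p.1) ⊗ₜ[K] Sprod K (exponents p.2) := by
  -- Adding the largest variable last turns into right multiplication by one complete function.
  induction m using Finsupp.induction_on_max with
  | zero => simp [exponents, Sprod_nil, Algebra.TensorProduct.one_def]
  | single_add k c m hk hc ih =>
    have hmk : m k = 0 := Finsupp.notMem_support_iff.1 fun h => lt_irrefl _ (hk k h)
    rw [add_comm, Sprod_exponents_add_single c hk, map_mul, ih, nsymCoproduct_S,
      sum_antidiagonal_add_single c hmk fun a b => Sprod K (exponents a) ⊗ₜ[K] Sprod K (exponents b),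
      Finset.sum_mul_sum]
    refine Finset.sum_congr rfl fun p hp => Finset.sum_congr rfl fun q hq => ?_
    have hp' := Finset.HasAntidiagonal.mem_antidiagonal.1 hp
    rw [Sprod_exponents_add_single, Sprod_exponents_add_single,
      Algebra.TensorProduct.tmul_mul_tmul]
    · intro i hi
      refine hk i ?_
      rw [Finsupp.mem_support_iff] at hi ⊢
      rw [← hp', Finsupp.add_apply]
      omega
    · intro i hi
      refine hk i ?_
      rw [Finsupp.mem_support_iff] at hi ⊢
      rw [← hp', Finsupp.add_apply]
      omega

/-! ### Quasi-symmetric functions -/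

theorem coeff_quasiMonomial (I : List ℕ) (m : ℕ →₀ ℕ) :
    MvPowerSeries.coeff m (quasiMonomial K I) = if exponents m = I then 1 else 0 := rfl

theorem pairing_add (F G : MvPowerSeries ℕ K) : pairing (F + G) = pairing F + pairing G :=
  (Sbasis K).ext fun I => by
    rw [LinearMap.add_apply, Sbasis_apply, pairing_Sprod _ fun i hi => I.2.blocks_pos hi,
      pairing_Sprod _ fun i hi => I.2.blocks_pos hi, pairing_Sprod _ fun i hi => I.2.blocks_pos hi,
      map_add]

theorem pairing_smul (r : K) (F : MvPowerSeries ℕ K) : pairing (r • F) = r • pairing F :=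
  (Sbasis K).ext fun I => by
    rw [LinearMap.smul_apply, Sbasis_apply, pairing_Sprod _ fun i hi => I.2.blocks_pos hi,
      pairing_Sprod _ fun i hi => I.2.blocks_pos hi, map_smul]

/-- The pairing as a linear map. -/
def pairingₗ (K : Type*) [Field K] : MvPowerSeries ℕ K →ₗ[K] NSym K →ₗ[K] K where
  toFun := pairing
  map_add' := pairing_add
  map_smul' := pairing_smul

@[simp] theorem pairingₗ_apply (F : MvPowerSeries ℕ K) : pairingₗ K F = pairing F := rfl

/-- This is quasi-symmetry: a coefficient depends only on the list of nonzero exponents, so the gaps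
between the variables can be closed. -/
theorem coeff_eq_pairing {F : MvPowerSeries ℕ K} (hF : F ∈ QSym K) (m : ℕ →₀ ℕ) :
    MvPowerSeries.coeff m F = pairing F (Sprod K (exponents m)) := by
  rw [pairing_Sprod _ fun i hi => pos_of_mem_exponents hi]
  induction hF using Submodule.span_induction with
  | mem F hF =>
    obtain ⟨n, I, rfl⟩ := hF
    rw [coeff_quasiMonomial, coeff_quasiMonomial,
      exponents_toFinsupp fun i hi => pos_of_mem_exponents hi]
  | zero => simp
  | add F G _ _ h1 h2 => rw [map_add, map_add, h1, h2]
  | smul r F _ h => rw [map_smul, map_smul, h]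

theorem QSym_ext {F G : MvPowerSeries ℕ K} (hF : F ∈ QSym K) (hG : G ∈ QSym K)
    (h : pairing F = pairing G) : F = G :=
  MvPowerSeries.ext fun m => by rw [coeff_eq_pairing hF, coeff_eq_pairing hG, h]

theorem pairing_quasiMonomial {n m : ℕ} (I : Composition n) (J : Composition m) :
    pairing (quasiMonomial K I.blocks) (Sprod K J.blocks) =
      if J.blocks = I.blocks then 1 else 0 := by
  rw [pairing_Sprod _ fun i hi => J.blocks_pos hi, coeff_quasiMonomial,
    exponents_toFinsupp fun i hi => J.blocks_pos hi]

theorem quasiMonomial_mem {n : ℕ} (I : Composition n) : quasiMonomial K I.blocks ∈ QSym K :=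
  Submodule.subset_span ⟨n, I, rfl⟩

/-- The splittings of the monomial m index both the product coefficient and the coproduct of the
corresponding $S^I$: the product of QSym is dual to the coproduct. -/
theorem coeff_mul_eq {F G : MvPowerSeries ℕ K} (hF : F ∈ QSym K) (hG : G ∈ QSym K) (m : ℕ →₀ ℕ) :
    MvPowerSeries.coeff m (F * G) =
      LinearMap.mul' K K (TensorProduct.map (pairing F) (pairing G)
        (nsymCoproduct K (Sprod K (exponents m)))) := by
  classical
  rw [MvPowerSeries.coeff_mul, nsymCoproduct_Sprod_exponents, map_sum, map_sum]
  refine Finset.sum_congr rfl fun p _ => ?_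
  rw [TensorProduct.map_tmul, LinearMap.mul'_apply, coeff_eq_pairing hF, coeff_eq_pairing hG]

end BinaryShuffle
end

/-! ### The bases V, X and Z attached to an arbitrary quotient map -/

open scoped TensorProduct
noncomputable section
namespace BinaryShuffle

variable {K : Type*} [Field K]

theorem span_eq_of_homogeneous {E : Type*} [AddCommGroup E] [Module K E]
    {ι : ℕ → Type*} [∀ n, Fintype (ι n)] (b v : Module.Basis (Σ n, ι n) K E)
    (hv : ∀ n i, v ⟨n, i⟩ ∈ Submodule.span K (Set.range fun j => b ⟨n, j⟩)) (n : ℕ) :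
    Submodule.span K (Set.range fun j => v ⟨n, j⟩) =
      Submodule.span K (Set.range fun j => b ⟨n, j⟩) := by
  have hli : ∀ c : Module.Basis (Σ n, ι n) K E, LinearIndependent K fun j => c ⟨n, j⟩ := fun c =>
    c.linearIndependent.comp (fun j : ι n => (⟨n, j⟩ : Σ n, ι n)) sigma_mk_injective
  have := FiniteDimensional.span_of_finite K (Set.finite_range fun j => b ⟨n, j⟩)
  refine Submodule.eq_of_le_of_finrank_eq (Submodule.span_le.2 ?_) ?_
  · rintro _ ⟨i, rfl⟩
    exact hv n i
  · rw [finrank_span_eq_card (hli v), finrank_span_eq_card (hli b)]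

theorem coord_eq_zero_of_mem {E : Type*} [AddCommGroup E] [Module K E]
    {ι : ℕ → Type*} (b : Module.Basis (Σ n, ι n) K E) {n m : ℕ} (i : ι n) (hnm : m ≠ n) {x : E}
    (hx : x ∈ Submodule.span K (Set.range fun j => b ⟨m, j⟩)) : b.coord ⟨n, i⟩ x = 0 := by
  have : Submodule.span K (Set.range fun j => b ⟨m, j⟩) ≤ LinearMap.ker (b.coord ⟨n, i⟩) := by
    rw [Submodule.span_le]
    rintro _ ⟨j, rfl⟩
    have : (⟨m, j⟩ : Σ n, ι n) ≠ ⟨n, i⟩ := fun h => hnm (congrArg Sigma.fst h)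
    simp [this]
  exact this hx

/-! ### The basis `V` -/

theorem exists_setPartition_of_length {n : ℕ} {w : List ℕ} (h : w.length = n) :
    ∃ π : SetPartition n, M K π = Mword K w ∧ sizeComp π = content w := by
  subst h
  obtain ⟨π, hπ, h⟩ := exists_M_eq_Mword (K := K) w
  exact ⟨π, h, sizeComp_eq (K := K) (by rw [hπ]; exact one_ne_zero)⟩

theorem sizeComp_eq_content_wordOf {n : ℕ} (π : SetPartition n) :
    sizeComp π = content (wordOf π) :=
  sizeComp_eq (K := ℚ) (by rw [wordOf_spec]; exact one_ne_zero)

theorem binWord_maxComp_wordOf {n : ℕ} (π : SetPartition n) :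
    binWord (maxComp π) = lastBits (wordOf π) :=
  binWord_maxComp (K := ℚ) (by rw [wordOf_spec]; exact one_ne_zero)

theorem IsStalacticQuotient.map_congr {p : WSym K →ₐ[K] NSym K} (hp : IsStalacticQuotient p)
    {u v : List ℕ} (h : content u = content v) :
    p (Mword K u) = p (Mword K v) := by
  have hl : v.length = u.length := by rw [← sum_content, ← sum_content, h]
  obtain ⟨π, h1, h2⟩ := exists_setPartition_of_length (K := K) (n := u.length) (w := u) rfl
  obtain ⟨π', h1', h2'⟩ := exists_setPartition_of_length (K := K) hl
  have : M K π - M K π' ∈ TwoSidedIdeal.ker p := by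
    rw [hp.ker_eq]
    exact TwoSidedIdeal.subset_span ⟨_, π, π', by rw [h2, h2', h], rfl⟩
  rw [TwoSidedIdeal.mem_ker, map_sub, sub_eq_zero] at this
  rw [← h1, ← h1', this]

/-- By uniqueness of coproducts in WSym, the tensor coming from p is the unshuffling sum. -/
theorem IsStalacticQuotient.map_lastSum {p : WSym K →ₐ[K] NSym K} (hp : IsStalacticQuotient p)
    (b : List Bool) :
    nsymCoproduct K (p (lastSum K b)) =
      ((unshuffle b).map fun q => p (lastSum K q.1) ⊗ₜ[K] p (lastSum K q.2)).sum := by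
  obtain ⟨t, ht, h⟩ := hp.map_coproduct (lastSum K b)
  rw [h, ht.eq (isCoproduct_lastSum b), map_list_sum, List.map_map]
  rfl

/-- The image of the class of the `M_π` with `K(π) = I`. -/
def classImage (p : WSym K →ₐ[K] NSym K) (I : Σ n, Composition n) : NSym K :=
  p (Mword K (intervalWord 0 I.2.blocks))

theorem IsStalacticQuotient.classImage_eq {p : WSym K →ₐ[K] NSym K} (hp : IsStalacticQuotient p)
    {n : ℕ} (I : Composition n) {w : List ℕ}
    (h : content w = I.blocks) : classImage p ⟨n, I⟩ = p (Mword K w) :=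
  hp.map_congr (by rw [h, content_intervalWord 0 fun i hi => I.blocks_pos hi])

theorem IsStalacticQuotient.classImage_mem {p : WSym K →ₐ[K] NSym K} (hp : IsStalacticQuotient p)
    (n : ℕ) (I : Composition n) :
    classImage p ⟨n, I⟩ ∈ Submodule.span K (Set.range fun J : Composition n => Sbasis K ⟨n, J⟩) := by
  rw [← nsymDegree_eq]
  have hl : (intervalWord 0 I.blocks).length = n := by
    rw [← sum_content, content_intervalWord 0 fun i hi => I.blocks_pos hi, I.blocks_sum]
  obtain ⟨π, h, -⟩ := exists_setPartition_of_length (K := K) hl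
  rw [classImage, ← h]
  exact hp.map_degree n π

theorem IsStalacticQuotient.classImage_span {p : WSym K →ₐ[K] NSym K} (hp : IsStalacticQuotient p)
    :
    ⊤ ≤ Submodule.span K (Set.range (classImage p)) := by
  intro x _
  obtain ⟨f, rfl⟩ := hp.surjective x
  induction f using Mword_induction with
  | h w =>
    rw [← hp.classImage_eq (contentComp w) rfl]
    exact Submodule.subset_span ⟨_, rfl⟩
  | h0 => rw [map_zero]; exact Submodule.zero_mem _
  | hadd f g h1 h2 => rw [map_add]; exact Submodule.add_mem _ (h1 trivial) (h2 trivial)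
  | hsmul r f h => rw [map_smul]; exact Submodule.smul_mem _ _ (h trivial)

/-- The basis `V` of the images of the classes. -/
def IsStalacticQuotient.Vbasis {p : WSym K →ₐ[K] NSym K} (hp : IsStalacticQuotient p)
    : Module.Basis (Σ n, Composition n) K (NSym K) :=
  Module.Basis.mk (linearIndependent_of_homogeneous (Sbasis K) (classImage p) hp.classImage_mem
    hp.classImage_span) hp.classImage_span

theorem IsStalacticQuotient.Vbasis_eq {p : WSym K →ₐ[K] NSym K} (hp : IsStalacticQuotient p)
    {n : ℕ} (I : Composition n) {w : List ℕ}
    (h : content w = I.blocks) : hp.Vbasis ⟨n, I⟩ = p (Mword K w) := by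
  rw [Vbasis, Module.Basis.mk_apply, hp.classImage_eq I h]

theorem IsStalacticQuotient.Vbasis_eq_M {p : WSym K →ₐ[K] NSym K} (hp : IsStalacticQuotient p)
    {n : ℕ} (I : Composition n) (π : SetPartition n)
    (h : sizeComp π = I.blocks) : hp.Vbasis ⟨n, I⟩ = p (M K π) := by
  rw [M_eq_Mword_wordOf]
  exact hp.Vbasis_eq I (by rw [← h, sizeComp_eq_content_wordOf])

theorem IsStalacticQuotient.Vbasis_mem {p : WSym K →ₐ[K] NSym K} (hp : IsStalacticQuotient p)
    (n : ℕ) (I : Composition n) :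
    hp.Vbasis ⟨n, I⟩ ∈ Submodule.span K (Set.range fun J : Composition n => Sbasis K ⟨n, J⟩) := by
  rw [Vbasis, Module.Basis.mk_apply]
  exact hp.classImage_mem n I

/-! ### The basis `X` -/

theorem IsStalacticQuotient.lastSum_eq {p : WSym K →ₐ[K] NSym K} (hp : IsStalacticQuotient p)
    {n : ℕ} (J : Composition n) :
    p (lastSum K (binWord J.blocks)) = ∑ I : Composition n, (c I J : K) • hp.Vbasis ⟨n, I⟩ := by
  rw [lastSum_eq_sum, map_sum, ← Finset.sum_fiberwise _ (fun π => sizeComposition π)]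
  refine Finset.sum_congr rfl fun I _ => ?_
  have h1 : ∀ π ∈ (Finset.univ.filter fun π : SetPartition n => maxComp π = J.blocks).filter
      (fun π => sizeComposition π = I), p (M K π) = hp.Vbasis ⟨n, I⟩ := by
    intro π hπ
    rw [Finset.mem_filter] at hπ
    exact (hp.Vbasis_eq_M I π (by rw [← hπ.2]; rfl)).symm
  rw [Finset.sum_congr rfl h1, Finset.sum_const, ← Nat.cast_smul_eq_nsmul K, c,
    Finset.filter_filter]
  congr 3
  ext π
  simp only [Finset.mem_filter, Finset.mem_univ, true_and, Composition.ext_iff]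
  exact and_comm

theorem exists_of_c_ne_zero {n : ℕ} {I J : Composition n} (h : c I J ≠ 0) :
    ∃ w, content w = I.blocks ∧ lastBits w = binWord J.blocks := by
  obtain ⟨π, hπ⟩ := Finset.card_ne_zero.1 h
  rw [Finset.mem_filter] at hπ
  exact ⟨wordOf π, by rw [← hπ.2.1, sizeComp_eq_content_wordOf],
    by rw [← hπ.2.2, binWord_maxComp_wordOf]⟩

/-- A partition counted by c is represented by a word, to which `bitsVal_lastBits_le` applies; equal
values would force equal binary words, because both have length n. -/
theorem bitsVal_lt_of_c_ne_zero {n : ℕ} {I J : Composition n} (h : c I J ≠ 0) (hIJ : I ≠ J) :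
    bitsVal (binWord J.blocks) < bitsVal (binWord I.blocks) := by
  obtain ⟨w, h1, h2⟩ := exists_of_c_ne_zero h
  refine lt_of_le_of_ne ?_ fun h3 => hIJ ?_
  · rw [← h1, ← h2]
    exact bitsVal_lastBits_le w
  · refine Composition.ext (binWord_injective (fun i hi => I.blocks_pos hi)
      (fun i hi => J.blocks_pos hi) (bitsVal_inj ?_ h3).symm)
    rw [length_binWord fun i hi => I.blocks_pos hi, length_binWord fun i hi => J.blocks_pos hi,
      I.blocks_sum, J.blocks_sum]

/-- The partition into consecutive intervals of sizes given by I is counted. -/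
theorem c_self_ne_zero {n : ℕ} (I : Composition n) : c I I ≠ 0 := by
  obtain ⟨w, h1, h2⟩ := exists_sizeComp I.blocks fun i hi => I.blocks_pos hi
  have hl : w.length = n := by rw [← sum_content, h1, I.blocks_sum]
  subst hl
  obtain ⟨π, hπ⟩ := exists_orbitSum (K := ℚ) w
  have hne : orbitSum ℚ π w ≠ 0 := by rw [hπ]; exact one_ne_zero
  refine Finset.card_ne_zero.2 ⟨π, Finset.mem_filter.2 ⟨Finset.mem_univ _, ?_, ?_⟩⟩
  · rw [sizeComp_eq hne, h1]
  · refine binWord_injective (pos_of_mem_maxComp π) (fun i hi => I.blocks_pos hi) ?_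
    rw [binWord_maxComp hne, h2]

/-- The family `X`. -/
def lastFamily (p : WSym K →ₐ[K] NSym K) (J : Σ n, Composition n) : NSym K :=
  p (lastSum K (binWord J.2.blocks))

theorem IsStalacticQuotient.lastFamily_mem {p : WSym K →ₐ[K] NSym K} (hp : IsStalacticQuotient p)
    (n : ℕ) (J : Composition n) :
    lastFamily p ⟨n, J⟩ ∈ Submodule.span K (Set.range fun I => hp.Vbasis ⟨n, I⟩) := by
  rw [lastFamily, hp.lastSum_eq]
  exact Submodule.sum_mem _ fun I _ => Submodule.smul_mem _ _ (Submodule.subset_span ⟨I, rfl⟩)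

theorem IsStalacticQuotient.Vbasis_mem_span_lastFamily {p : WSym K →ₐ[K] NSym K} (hp : IsStalacticQuotient p)
    [CharZero K] (n : ℕ) (J : Composition n) :
    hp.Vbasis ⟨n, J⟩ ∈ Submodule.span K (Set.range (lastFamily p)) := by
  -- Triangular inversion, starting from the largest binary values: the other $V_I$ occurring in
  -- $X_J$ have larger values, bounded by $2^n$. Characteristic 0 is used to invert the diagonal
  -- entry.
  induction h : 2 ^ n - bitsVal (binWord J.blocks) using Nat.strong_induction_on generalizing J with
  | _ k ih =>
    have hc : (c J J : K) ≠ 0 := Nat.cast_ne_zero.2 (c_self_ne_zero J)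
    have h1 := hp.lastSum_eq J
    rw [← Finset.add_sum_erase _ _ (Finset.mem_univ J)] at h1
    have h2 : hp.Vbasis ⟨n, J⟩ = (c J J : K)⁻¹ • (lastFamily p ⟨n, J⟩ -
        ∑ I ∈ Finset.univ.erase J, (c I J : K) • hp.Vbasis ⟨n, I⟩) := by
      rw [lastFamily, h1, add_sub_cancel_right, smul_smul, inv_mul_cancel₀ hc, one_smul]
    rw [h2]
    refine Submodule.smul_mem _ _ (Submodule.sub_mem _ (Submodule.subset_span ⟨_, rfl⟩)
      (Submodule.sum_mem _ fun I hI => ?_))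
    by_cases h0 : c I J = 0
    · rw [h0, Nat.cast_zero, zero_smul]
      exact Submodule.zero_mem _
    · refine Submodule.smul_mem _ _ (ih _ ?_ I rfl)
      have hlt := bitsVal_lt_of_c_ne_zero h0 (Finset.ne_of_mem_erase hI)
      have hb := bitsVal_lt (binWord I.blocks)
      rw [length_binWord fun i hi => I.blocks_pos hi, I.blocks_sum] at hb
      omega

theorem IsStalacticQuotient.lastFamily_span {p : WSym K →ₐ[K] NSym K} (hp : IsStalacticQuotient p)
    [CharZero K] :
    ⊤ ≤ Submodule.span K (Set.range (lastFamily p)) := by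
  rw [← hp.Vbasis.span_eq, Submodule.span_le]
  rintro _ ⟨⟨n, J⟩, rfl⟩
  exact hp.Vbasis_mem_span_lastFamily n J

/-- The basis `X`. -/
def IsStalacticQuotient.Xbasis {p : WSym K →ₐ[K] NSym K} (hp : IsStalacticQuotient p)
    [CharZero K] : Module.Basis (Σ n, Composition n) K (NSym K) :=
  Module.Basis.mk (linearIndependent_of_homogeneous hp.Vbasis (lastFamily p) hp.lastFamily_mem
    hp.lastFamily_span) hp.lastFamily_span

theorem IsStalacticQuotient.Xbasis_apply {p : WSym K →ₐ[K] NSym K} (hp : IsStalacticQuotient p)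
    [CharZero K] (J : Σ n, Composition n) :
    hp.Xbasis J = p (lastSum K (binWord J.2.blocks)) := by
  rw [Xbasis, Module.Basis.mk_apply, lastFamily]

theorem IsStalacticQuotient.span_Xbasis {p : WSym K →ₐ[K] NSym K} (hp : IsStalacticQuotient p)
    [CharZero K] (n : ℕ) :
    Submodule.span K (Set.range fun J => hp.Xbasis ⟨n, J⟩) =
      Submodule.span K (Set.range fun J => Sbasis K ⟨n, J⟩) := by
  rw [span_eq_of_homogeneous hp.Vbasis hp.Xbasis, span_eq_of_homogeneous _ _ hp.Vbasis_mem]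
  intro n J
  rw [Xbasis, Module.Basis.mk_apply]
  exact hp.lastFamily_mem n J

theorem IsStalacticQuotient.nsymCoproduct_Xbasis {p : WSym K →ₐ[K] NSym K} (hp : IsStalacticQuotient p)
    [CharZero K] (L : Σ n, Composition n) :
    nsymCoproduct K (hp.Xbasis L) = ((unshuffle (binWord L.2.blocks)).map fun q =>
      p (lastSum K q.1) ⊗ₜ[K] p (lastSum K q.2)).sum := by
  rw [hp.Xbasis_apply, hp.map_lastSum]

/-- A binary word ending in 0 gives the zero sum and encodes no composition; any other one encodes a
composition, and its sum maps to a member of the basis X. The formula can thus be applied to all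
unshuffled pieces alike. -/
theorem IsStalacticQuotient.coord_lastSum {p : WSym K →ₐ[K] NSym K} (hp : IsStalacticQuotient p)
    [CharZero K] (I : Σ n, Composition n) (b : List Bool) :
    hp.Xbasis.coord I (p (lastSum K b)) = if b = binWord I.2.blocks then 1 else 0 := by
  by_cases hb : b.getLast? = some false
  · rw [lastSum_eq_zero hb, map_zero, map_zero, if_neg]
    rintro rfl
    obtain ⟨w, -, hw⟩ := exists_sizeComp I.2.blocks fun i hi => I.2.blocks_pos hi
    exact getLast?_lastBits w (by rw [hw, hb])
  · obtain ⟨J, hJ, rfl⟩ := exists_binWord b hb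
    have := hp.Xbasis_apply ⟨J.sum, compOf J hJ⟩
    rw [compOf] at this
    simp only at this
    rw [← this, Module.Basis.coord_apply, Module.Basis.repr_self, Finsupp.single_apply]
    congr 1
    refine propext ⟨?_, fun h => ?_⟩
    · rintro rfl
      rfl
    · exact composition_ext (binWord_injective hJ (fun i hi => I.2.blocks_pos hi) h)

/-! ### The dual basis `Z` -/

/-- The family `Z`, dual to `X`. -/
def IsStalacticQuotient.dualFamily {p : WSym K →ₐ[K] NSym K} (hp : IsStalacticQuotient p)
    [CharZero K] (I : Σ n, Composition n) : MvPowerSeries ℕ K :=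
  ∑ J : Composition I.1, hp.Xbasis.coord I (Sprod K J.blocks) • quasiMonomial K J.blocks

theorem IsStalacticQuotient.dualFamily_mem {p : WSym K →ₐ[K] NSym K} (hp : IsStalacticQuotient p)
    [CharZero K] (I : Σ n, Composition n) : hp.dualFamily I ∈ QSym K :=
  Submodule.sum_mem _ fun J _ => Submodule.smul_mem _ _ (quasiMonomial_mem J)

theorem IsStalacticQuotient.pairing_dualFamily {p : WSym K →ₐ[K] NSym K} (hp : IsStalacticQuotient p)
    [CharZero K] (I : Σ n, Composition n) :
    pairing (hp.dualFamily I) = hp.Xbasis.coord I := by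
  obtain ⟨n, I⟩ := I
  refine (Sbasis K).ext fun ⟨m, L⟩ => ?_
  rw [← pairingₗ_apply, dualFamily, map_sum, LinearMap.sum_apply]
  simp only [map_smul, LinearMap.smul_apply, pairingₗ_apply, Sbasis_apply, pairing_quasiMonomial,
    smul_eq_mul, mul_ite, mul_one, mul_zero]
  by_cases hmn : m = n
  · subst hmn
    rw [Finset.sum_eq_single L]
    · simp
    · intro J _ hJ
      exact if_neg fun h => hJ (Composition.ext h.symm)
    · simp
  · rw [coord_eq_zero_of_mem _ _ hmn, Finset.sum_eq_zero]
    · intro J _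
      refine if_neg fun h => hmn ?_
      rw [← L.blocks_sum, h, J.blocks_sum]
    · rw [hp.span_Xbasis]
      exact Submodule.subset_span ⟨L, Sbasis_apply K _⟩

theorem IsStalacticQuotient.pairing_dualFamily_Xbasis {p : WSym K →ₐ[K] NSym K} (hp : IsStalacticQuotient p)
    [CharZero K] (I J : Σ n, Composition n) :
    pairing (hp.dualFamily I) (hp.Xbasis J) = if I = J then 1 else 0 := by
  rw [pairing_dualFamily, Module.Basis.coord_apply, Module.Basis.repr_self, Finsupp.single_apply]
  simp only [eq_comm]

/-- Elements of QSym are determined by their pairings, so the two sides are compared on the $X_L$;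
in a degree other than n both give 0. It follows that Z spans QSym. -/
theorem IsStalacticQuotient.quasiMonomial_eq {p : WSym K →ₐ[K] NSym K} (hp : IsStalacticQuotient p)
    [CharZero K] {n : ℕ} (I : Composition n) :
    quasiMonomial K I.blocks = ∑ J : Composition n,
      pairing (quasiMonomial K I.blocks) (hp.Xbasis ⟨n, J⟩) • hp.dualFamily ⟨n, J⟩ := by
  refine QSym_ext (quasiMonomial_mem I) (Submodule.sum_mem _ fun J _ =>
    Submodule.smul_mem _ _ (hp.dualFamily_mem _)) (hp.Xbasis.ext fun ⟨m, L⟩ => ?_)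
  rw [← pairingₗ_apply (∑ _ ∈ _, _), map_sum, LinearMap.sum_apply]
  simp only [map_smul, LinearMap.smul_apply, pairingₗ_apply, hp.pairing_dualFamily_Xbasis,
    smul_eq_mul, mul_ite, mul_one, mul_zero]
  by_cases hmn : m = n
  · subst hmn
    rw [Finset.sum_eq_single L]
    · simp
    · intro J _ hJ
      exact if_neg fun h => hJ (by simpa using h)
    · simp
  · rw [Finset.sum_eq_zero]
    · have hle : Submodule.span K (Set.range fun J : Composition m => Sbasis K ⟨m, J⟩) ≤
          LinearMap.ker (pairing (quasiMonomial K I.blocks)) := by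
        rw [Submodule.span_le]
        rintro _ ⟨J, rfl⟩
        rw [SetLike.mem_coe, LinearMap.mem_ker]
        beta_reduce
        rw [Sbasis_apply, pairing_quasiMonomial, if_neg]
        intro h
        exact hmn (by rw [← J.blocks_sum, h, I.blocks_sum])
      rw [← hp.span_Xbasis] at hle
      exact hle (Submodule.subset_span ⟨L, rfl⟩)
    · intro J _
      exact if_neg fun h => hmn (congrArg Sigma.fst h).symm

/-- The basis `Z`. -/
def IsStalacticQuotient.Zbasis {p : WSym K →ₐ[K] NSym K} (hp : IsStalacticQuotient p)
    [CharZero K] : Module.Basis (Σ n, Composition n) K (QSym K) :=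
  Module.Basis.mk (v := fun I => ⟨hp.dualFamily I, hp.dualFamily_mem I⟩)
    (by
      rw [linearIndependent_iff]
      intro l hl
      ext J
      have := congrArg (fun F : QSym K => pairingₗ K F.1 (hp.Xbasis J)) hl
      simp only [Finsupp.linearCombination_apply, Finsupp.sum, AddSubmonoidClass.coe_finsetSum,
        map_sum, LinearMap.sum_apply, SetLike.val_smul, map_smul, LinearMap.smul_apply,
        pairingₗ_apply, hp.pairing_dualFamily_Xbasis, ZeroMemClass.coe_zero] at this
      rw [← pairingₗ_apply, map_zero, LinearMap.zero_apply] at this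
      simpa using this)
    (by
      rintro ⟨F, hF⟩ _
      change F ∈ Submodule.span K _ at hF
      induction hF using Submodule.span_induction with
      | mem F hF =>
        obtain ⟨n, I, rfl⟩ := hF
        have h : (⟨quasiMonomial K I.blocks, quasiMonomial_mem I⟩ : QSym K) =
            ∑ J : Composition n, pairing (quasiMonomial K I.blocks) (hp.Xbasis ⟨n, J⟩) •
              (⟨hp.dualFamily ⟨n, J⟩, hp.dualFamily_mem _⟩ : QSym K) := by
          refine Subtype.ext ((hp.quasiMonomial_eq I).trans ?_)
          simp
        rw [h]
        exact Submodule.sum_mem _ fun J _ => Submodule.smul_mem _ _ (Submodule.subset_span ⟨_, rfl⟩)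
      | zero => exact Submodule.zero_mem _
      | add F G h1 h2 ih1 ih2 =>
        exact Submodule.add_mem _ (ih1 trivial) (ih2 trivial)
      | smul r F h ih => exact Submodule.smul_mem _ r (ih trivial))

theorem IsStalacticQuotient.Zbasis_apply {p : WSym K →ₐ[K] NSym K} (hp : IsStalacticQuotient p)
    [CharZero K] (I : Σ n, Composition n) :
    (hp.Zbasis I : MvPowerSeries ℕ K) = hp.dualFamily I := by
  rw [Zbasis, Module.Basis.mk_apply]

/-- Pairing with $X_L$ counts the unshufflings of $\epsilon_L$ into $\epsilon_I$ and $\epsilon_J$,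
which is the shuffle coefficient. -/
theorem IsStalacticQuotient.dualFamily_mul {p : WSym K →ₐ[K] NSym K} (hp : IsStalacticQuotient p)
    [CharZero K] (n m : ℕ) (I : Composition n) (J : Composition m) :
    hp.dualFamily ⟨n, I⟩ * hp.dualFamily ⟨m, J⟩ = ∑ L : Composition (n + m),
      (shuffleCoeff (binWord L.blocks) (binWord I.blocks) (binWord J.blocks) : K) •
        hp.dualFamily ⟨n + m, L⟩ := by
  have key : (LinearMap.mul' K K ∘ₗ TensorProduct.map (hp.Xbasis.coord ⟨n, I⟩)
      (hp.Xbasis.coord ⟨m, J⟩)) ∘ₗ (nsymCoproduct K).toLinearMap = ∑ L : Composition (n + m),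
      (shuffleCoeff (binWord L.blocks) (binWord I.blocks) (binWord J.blocks) : K) •
        hp.Xbasis.coord ⟨n + m, L⟩ := by
    refine hp.Xbasis.ext fun ⟨k, L⟩ => ?_
    have h1 : ((LinearMap.mul' K K ∘ₗ TensorProduct.map (hp.Xbasis.coord ⟨n, I⟩)
        (hp.Xbasis.coord ⟨m, J⟩)) ∘ₗ (nsymCoproduct K).toLinearMap) (hp.Xbasis ⟨k, L⟩) =
        shuffleCoeff (binWord L.blocks) (binWord I.blocks) (binWord J.blocks) := by
      rw [LinearMap.comp_apply, AlgHom.toLinearMap_apply, hp.nsymCoproduct_Xbasis, map_list_sum,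
        List.map_map, shuffleCoeff, ← count_unshuffle, ← sum_map_ite_count]
      congr 1
      refine List.map_congr_left fun q _ => ?_
      rw [Function.comp_apply, LinearMap.comp_apply, TensorProduct.map_tmul, LinearMap.mul'_apply,
        hp.coord_lastSum, hp.coord_lastSum]
      by_cases h1 : q.1 = binWord I.blocks <;> by_cases h2 : q.2 = binWord J.blocks <;>
        simp [Prod.ext_iff, h1, h2]
    rw [h1, LinearMap.sum_apply]
    simp only [LinearMap.smul_apply, Module.Basis.coord_apply, Module.Basis.repr_self,
      Finsupp.single_apply, smul_eq_mul, mul_ite, mul_one, mul_zero]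
    by_cases hk : k = n + m
    · subst hk
      rw [Finset.sum_eq_single L]
      · simp
      · intro L' _ hL
        exact if_neg fun h => hL (by simpa [eq_comm] using h)
      · simp
    · rw [Finset.sum_eq_zero]
      -- Shuffling adds lengths, so the coefficient vanishes outside degree n + m and the finite sum
      -- misses nothing.
      · rw [shuffleCoeff, Nat.cast_eq_zero, List.count_eq_zero]
        intro h
        have := length_of_mem_shuffle _ _ h
        rw [length_binWord fun i hi => L.blocks_pos hi, length_binWord fun i hi => I.blocks_pos hi,
          length_binWord fun i hi => J.blocks_pos hi, L.blocks_sum, I.blocks_sum,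
          J.blocks_sum] at this
        exact hk this
      · intro L' _
        exact if_neg fun h => hk (congrArg Sigma.fst h)
  refine MvPowerSeries.ext fun e => ?_
  rw [coeff_mul_eq (hp.dualFamily_mem _) (hp.dualFamily_mem _), hp.pairing_dualFamily,
    hp.pairing_dualFamily, map_sum]
  refine (LinearMap.congr_fun key _).trans ?_
  rw [LinearMap.sum_apply]
  refine Finset.sum_congr rfl fun L _ => ?_
  rw [map_smul, coeff_eq_pairing (hp.dualFamily_mem _), hp.pairing_dualFamily, LinearMap.smul_apply]

end BinaryShuffle
end

/-! ### Existence of the quotient map: the elements V built inside NSym -/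

open scoped TensorProduct
noncomputable section
namespace BinaryShuffle

/-! ### Primitive generators of `NSym` -/

variable (K : Type*) [Field K]

/-- The primitive elements `P_n` with `n S_n = ∑_{i + j = n} P_i S_j`. -/
def psum : ℕ → NSym K
  | n => (n : K) • S K n - ∑ i : Fin n, psum i * S K (n - i)

theorem sum_psum_mul_S (n : ℕ) :
    ∑ q ∈ Finset.HasAntidiagonal.antidiagonal n, psum K q.1 * S K q.2 = (n : K) • S K n := by
  rw [Finset.Nat.sum_antidiagonal_eq_sum_range_succ fun i j => psum K i * S K j,
    Finset.sum_range_succ, Nat.sub_self, S_zero, mul_one]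
  conv_lhs => enter [2]; rw [psum]
  rw [Fin.sum_univ_eq_sum_range (fun i => psum K i * S K (n - i)), add_sub_cancel]

@[simp] theorem psum_zero : psum K 0 = 0 := by
  have := sum_psum_mul_S K 0
  simpa using this

theorem sum_antidiagonal_assoc {E : Type*} [AddCommMonoid E] (n : ℕ) (f : ℕ → ℕ → ℕ → E) :
    ∑ q ∈ Finset.HasAntidiagonal.antidiagonal n,
      ∑ r ∈ Finset.HasAntidiagonal.antidiagonal q.1, f r.1 r.2 q.2 =
    ∑ q ∈ Finset.HasAntidiagonal.antidiagonal n,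
      ∑ r ∈ Finset.HasAntidiagonal.antidiagonal q.2, f q.1 r.1 r.2 := by
  rw [Finset.sum_sigma', Finset.sum_sigma']
  refine Finset.sum_nbij' (fun x => ⟨(x.2.1, x.2.2 + x.1.2), (x.2.2, x.1.2)⟩)
    (fun x => ⟨(x.1.1 + x.2.1, x.2.2), (x.1.1, x.2.1)⟩) ?_ ?_ ?_ ?_ ?_
  · rintro ⟨⟨a, b⟩, ⟨i, j⟩⟩ h
    simp only [Finset.mem_sigma, Finset.HasAntidiagonal.mem_antidiagonal] at h ⊢
    obtain ⟨rfl, rfl⟩ := h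
    exact ⟨(Nat.add_assoc _ _ _).symm, trivial⟩
  · rintro ⟨⟨a, b⟩, ⟨i, j⟩⟩ h
    simp only [Finset.mem_sigma, Finset.HasAntidiagonal.mem_antidiagonal] at h ⊢
    obtain ⟨rfl, rfl⟩ := h
    exact ⟨Nat.add_assoc _ _ _, trivial⟩
  · rintro ⟨⟨a, b⟩, ⟨i, j⟩⟩ h
    simp only [Finset.mem_sigma, Finset.HasAntidiagonal.mem_antidiagonal] at h
    obtain ⟨-, rfl⟩ := h
    rfl
  · rintro ⟨⟨a, b⟩, ⟨i, j⟩⟩ h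
    simp only [Finset.mem_sigma, Finset.HasAntidiagonal.mem_antidiagonal] at h
    obtain ⟨-, rfl⟩ := h
    rfl
  · rintro ⟨⟨a, b⟩, ⟨i, j⟩⟩ h
    rfl

/-- Multiplication by the degree is a derivation: on $S_i\otimes S_j$ the factor n splits as i + j,
and each half is expanded by the recursion defining the $P_n$. -/
theorem nsymCoproduct_smul_S (n : ℕ) :
    nsymCoproduct K ((n : K) • S K n) = ∑ q ∈ Finset.HasAntidiagonal.antidiagonal n,
      (psum K q.1 ⊗ₜ[K] 1 + 1 ⊗ₜ[K] psum K q.1) * nsymCoproduct K (S K q.2) := by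
  have h1 := sum_antidiagonal_assoc n fun i j b => (psum K i * S K j) ⊗ₜ[K] S K b
  have h2 := sum_antidiagonal_assoc n fun i j b => S K b ⊗ₜ[K] (psum K i * S K j)
  rw [map_smul, nsymCoproduct_S, Finset.smul_sum]
  calc ∑ q ∈ Finset.HasAntidiagonal.antidiagonal n, (n : K) • S K q.1 ⊗ₜ[K] S K q.2
      = ∑ q ∈ Finset.HasAntidiagonal.antidiagonal n,
          (((q.1 : K) • S K q.1) ⊗ₜ[K] S K q.2 + S K q.1 ⊗ₜ[K] ((q.2 : K) • S K q.2)) := by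
        refine Finset.sum_congr rfl fun q hq => ?_
        rw [Finset.HasAntidiagonal.mem_antidiagonal] at hq
        rw [← hq, Nat.cast_add, add_smul, TensorProduct.smul_tmul', TensorProduct.tmul_smul,
          TensorProduct.smul_tmul']
    _ = ∑ q ∈ Finset.HasAntidiagonal.antidiagonal n, ((q.1 : K) • S K q.1) ⊗ₜ[K] S K q.2 +
        ∑ q ∈ Finset.HasAntidiagonal.antidiagonal n, S K q.2 ⊗ₜ[K] ((q.1 : K) • S K q.1) := by
        rw [Finset.sum_add_distrib]
        congr 1
        exact Finset.Nat.sum_antidiagonal_swap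
          (f := fun q : ℕ × ℕ => S K q.2 ⊗ₜ[K] ((q.1 : K) • S K q.1))
    _ = _ := by
        simp only [← sum_psum_mul_S, TensorProduct.sum_tmul, TensorProduct.tmul_sum]
        rw [h1, h2, ← Finset.sum_add_distrib]
        refine Finset.sum_congr rfl fun q _ => ?_
        rw [nsymCoproduct_S, add_mul, Finset.mul_sum, Finset.mul_sum]
        congr 1
        · refine Finset.sum_congr rfl fun r _ => ?_
          rw [Algebra.TensorProduct.tmul_mul_tmul, one_mul]
        · rw [← Finset.Nat.sum_antidiagonal_swap]
          refine Finset.sum_congr rfl fun r _ => ?_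
          rw [Algebra.TensorProduct.tmul_mul_tmul, one_mul]
          rfl

/-- Two expansions of $\Delta(nS_n)$ agree termwise below the top index by induction; the remaining
top term is multiplied by $S_0=1$, so it can be read off. -/
theorem nsymCoproduct_psum (n : ℕ) :
    nsymCoproduct K (psum K n) = psum K n ⊗ₜ[K] 1 + 1 ⊗ₜ[K] psum K n := by
  induction n using Nat.strong_induction_on with
  | _ n ih =>
    have h := nsymCoproduct_smul_S K n
    rw [← sum_psum_mul_S, map_sum] at h
    simp only [map_mul] at h
    rw [Finset.Nat.sum_antidiagonal_eq_sum_range_succ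
        fun i j => nsymCoproduct K (psum K i) * nsymCoproduct K (S K j),
      Finset.Nat.sum_antidiagonal_eq_sum_range_succ
        fun i j => (psum K i ⊗ₜ[K] 1 + 1 ⊗ₜ[K] psum K i) * nsymCoproduct K (S K j),
      Finset.sum_range_succ, Finset.sum_range_succ, Nat.sub_self, S_zero, map_one, mul_one,
      mul_one, Finset.sum_congr rfl fun i hi => by rw [ih i (Finset.mem_range.1 hi)]] at h
    exact add_left_cancel h

theorem Sprod_mem_nsymDegree (L : List ℕ) : Sprod K L ∈ nsymDegree K L.sum := by
  have hs : (L.filter (0 < ·)).sum = L.sum := by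
    induction L with
    | nil => rfl
    | cons i L ih =>
      obtain rfl | hi := Nat.eq_zero_or_pos i
      · rw [List.filter_cons_of_neg (by simp), ih]; simp
      · rw [List.filter_cons_of_pos (by simpa using hi), List.sum_cons, ih, List.sum_cons]
  rw [← Sprod_filter]
  exact Submodule.subset_span ⟨⟨L.filter (0 < ·), fun {i} hi => by
    simpa using (List.mem_filter.1 hi).2, hs⟩, rfl⟩

theorem S_mem_nsymDegree (n : ℕ) : S K n ∈ nsymDegree K n := by
  simpa [Sprod] using Sprod_mem_nsymDegree K [n]

variable {K} in
theorem mul_mem_nsymDegree {n m : ℕ} {x y : NSym K} (hx : x ∈ nsymDegree K n)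
    (hy : y ∈ nsymDegree K m) : x * y ∈ nsymDegree K (n + m) := by
  refine Submodule.mul_le.1 (le_of_eq_of_le (Submodule.span_mul_span K _ _)
    (Submodule.span_le.2 ?_)) x hx y hy
  rintro _ ⟨_, ⟨I, rfl⟩, _, ⟨J, rfl⟩, rfl⟩
  have h := Sprod_mem_nsymDegree K (I.blocks ++ J.blocks)
  rw [List.sum_append, I.blocks_sum, J.blocks_sum, Sprod_append] at h
  exact h

theorem psum_mem_nsymDegree (n : ℕ) : psum K n ∈ nsymDegree K n := by
  induction n using Nat.strong_induction_on with
  | _ n ih =>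
    rw [psum]
    refine Submodule.sub_mem _ (Submodule.smul_mem _ _ (S_mem_nsymDegree K n))
      (Submodule.sum_mem _ fun i _ => ?_)
    have := mul_mem_nsymDegree (ih i i.2) (S_mem_nsymDegree K (n - i))
    rwa [Nat.add_sub_cancel' i.2.le] at this

/-! ### The elements `V_I` of `NSym` -/

/-- All the ways to add `i` to a part of a list. -/
def merges (i : ℕ) : List ℕ → List (List ℕ)
  | [] => []
  | j :: J => ((i + j) :: J) :: (merges i J).map (List.cons j)

theorem length_of_mem_merges {i : ℕ} {J J' : List ℕ} (h : J' ∈ merges i J) :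
    J'.length = J.length := by
  induction J generalizing J' with
  | nil => simp [merges] at h
  | cons j J ih =>
    simp only [merges, List.mem_cons, List.mem_map] at h
    rcases h with rfl | ⟨J'', h, rfl⟩
    · rfl
    · simp [ih h]

theorem sum_of_mem_merges {i : ℕ} {J J' : List ℕ} (h : J' ∈ merges i J) :
    J'.sum = i + J.sum := by
  induction J generalizing J' with
  | nil => simp [merges] at h
  | cons j J ih =>
    simp only [merges, List.mem_cons, List.mem_map] at h
    rcases h with rfl | ⟨J'', h, rfl⟩
    · simp [add_assoc]
    · simp only [List.sum_cons, ih h]; omega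

/-- The elements `V_I`, determined by `P_i V_J = V_{iJ} + ∑ V_{J'}`, where `J'` runs over the
lists obtained by adding `i` to a part of `J`. -/
def Vlist : List ℕ → NSym K
  | [] => 1
  | i :: J => psum K i * Vlist J - ((merges i J).attach.map fun x => Vlist x.1).sum
termination_by I => I.length
decreasing_by
  · simp
  · simp [length_of_mem_merges x.2]

theorem Vlist_cons (i : ℕ) (J : List ℕ) :
    Vlist K (i :: J) = psum K i * Vlist K J - ((merges i J).map (Vlist K)).sum := by
  rw [Vlist]
  congr 2
  exact List.attach_map_val (f := Vlist K)

theorem psum_mul_Vlist (i : ℕ) (J : List ℕ) :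
    psum K i * Vlist K J = Vlist K (i :: J) + ((merges i J).map (Vlist K)).sum := by
  rw [Vlist_cons, sub_add_cancel]

theorem Vlist_mem_nsymDegree (I : List ℕ) : Vlist K I ∈ nsymDegree K I.sum := by
  induction h : I.length generalizing I with
  | zero =>
    rw [List.length_eq_zero_iff] at h
    subst h
    rw [Vlist]
    exact Sprod_mem_nsymDegree K []
  | succ k ih =>
    obtain _ | ⟨i, J⟩ := I
    · simp at h
    rw [Vlist_cons]
    have hJ : J.length = k := by simpa using h
    refine Submodule.sub_mem _ (mul_mem_nsymDegree (psum_mem_nsymDegree K i) (ih J hJ))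
      (list_sum_mem fun x hx => ?_)
    obtain ⟨J', hJ', rfl⟩ := List.mem_map.1 hx
    rw [List.sum_cons, ← sum_of_mem_merges hJ']
    exact ih J' (by rw [length_of_mem_merges hJ', hJ])

/-- Sums over the ways to split a word into two complementary subwords. -/
def unshuffleSum {α E : Type*} [AddCommMonoid E] (f : List α → List α → E) (w : List α) : E :=
  ((unshuffle w).map fun q => f q.1 q.2).sum

theorem unshuffleSum_nil {α E : Type*} [AddCommMonoid E] (f : List α → List α → E) :
    unshuffleSum f [] = f [] [] := by simp [unshuffleSum, unshuffle]

theorem unshuffleSum_cons {α E : Type*} [AddCommMonoid E] (f : List α → List α → E) (a : α)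
    (w : List α) : unshuffleSum f (a :: w) =
      unshuffleSum (fun x y => f (a :: x) y) w + unshuffleSum (fun x y => f x (a :: y)) w := by
  simp [unshuffleSum, unshuffle, Function.comp_def]

theorem unshuffleSum_add {α E : Type*} [AddCommMonoid E] (f g : List α → List α → E)
    (w : List α) :
    unshuffleSum (fun x y => f x y + g x y) w = unshuffleSum f w + unshuffleSum g w :=
  List.sum_map_add

theorem map_unshuffleSum {α E F : Type*} [AddCommMonoid E] [AddCommMonoid F] (φ : E →+ F)
    (f : List α → List α → E) (w : List α) :
    φ (unshuffleSum f w) = unshuffleSum (fun x y => φ (f x y)) w := by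
  rw [unshuffleSum, map_list_sum, List.map_map]
  rfl

/-- Increasing a part and then splitting the list is the same as splitting first and increasing that
part on the side where it lands. -/
theorem sum_merges_unshuffleSum {E : Type*} [AddCommMonoid E] (i : ℕ) (J : List ℕ)
    (f : List ℕ → List ℕ → E) :
    ((merges i J).map (unshuffleSum f)).sum = unshuffleSum (fun x y =>
      ((merges i x).map fun x' => f x' y).sum + ((merges i y).map fun y' => f x y').sum) J := by
  induction J generalizing f with
  | nil => simp [merges, unshuffleSum_nil]
  | cons j J ih =>
    have h1 := ih fun x y => f (j :: x) y
    have h2 := ih fun x y => f x (j :: y)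
    rw [merges, List.map_cons, List.sum_cons, List.map_map, unshuffleSum_cons, unshuffleSum_cons]
    simp only [Function.comp_def, unshuffleSum_cons, List.sum_map_add]
    simp only [merges, List.map_cons, List.sum_cons, List.map_map, Function.comp_def,
      unshuffleSum_add] at h1 h2 ⊢
    rw [h1, h2]
    abel

/-- Induction on length along the defining recursion: since $P_i$ is primitive, i is either
prepended to or merged into one tensor factor. The merging terms cancel by
`sum_merges_unshuffleSum`, leaving the unshufflings in which i is the first letter of a side. -/
theorem nsymCoproduct_Vlist (I : List ℕ) :
    nsymCoproduct K (Vlist K I) = unshuffleSum (fun x y => Vlist K x ⊗ₜ[K] Vlist K y) I := by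
  induction h : I.length generalizing I with
  | zero =>
    rw [List.length_eq_zero_iff] at h
    subst h
    rw [unshuffleSum_nil, Vlist, map_one, Algebra.TensorProduct.one_def]
  | succ k ih =>
    obtain _ | ⟨i, J⟩ := I
    · simp at h
    have hJ : J.length = k := by simpa using h
    have h1 : (merges i J).map (fun J' => nsymCoproduct K (Vlist K J')) =
        (merges i J).map (unshuffleSum fun x y => Vlist K x ⊗ₜ[K] Vlist K y) :=
      List.map_congr_left fun J' hJ' => ih J' (by rw [length_of_mem_merges hJ', hJ])
    have h2 : ∀ x y : List ℕ, (psum K i ⊗ₜ[K] 1 + 1 ⊗ₜ[K] psum K i) * Vlist K x ⊗ₜ[K] Vlist K y =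
        (Vlist K (i :: x) ⊗ₜ[K] Vlist K y + Vlist K x ⊗ₜ[K] Vlist K (i :: y)) +
        (((merges i x).map fun x' => Vlist K x' ⊗ₜ[K] Vlist K y).sum +
          ((merges i y).map fun y' => Vlist K x ⊗ₜ[K] Vlist K y').sum) := by
      intro x y
      have e1 : ((merges i x).map fun x' => Vlist K x' ⊗ₜ[K] Vlist K y).sum =
          ((merges i x).map (Vlist K)).sum ⊗ₜ[K] Vlist K y := by
        have := map_list_sum ((TensorProduct.mk K (NSym K) (NSym K)).flip (Vlist K y))
          ((merges i x).map (Vlist K))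
        rw [List.map_map] at this
        exact this.symm
      have e2 : ((merges i y).map fun y' => Vlist K x ⊗ₜ[K] Vlist K y').sum =
          Vlist K x ⊗ₜ[K] ((merges i y).map (Vlist K)).sum := by
        have := map_list_sum (TensorProduct.mk K (NSym K) (NSym K) (Vlist K x))
          ((merges i y).map (Vlist K))
        rw [List.map_map] at this
        exact this.symm
      rw [e1, e2, add_mul, Algebra.TensorProduct.tmul_mul_tmul,
        Algebra.TensorProduct.tmul_mul_tmul, one_mul, one_mul, psum_mul_Vlist, psum_mul_Vlist,
        TensorProduct.add_tmul, TensorProduct.tmul_add]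
      abel
    rw [Vlist_cons, map_sub, map_mul, nsymCoproduct_psum, ih J hJ, map_list_sum, List.map_map]
    change _ - ((merges i J).map (fun J' => nsymCoproduct K (Vlist K J'))).sum = _
    rw [h1, sum_merges_unshuffleSum, unshuffleSum_cons, ← unshuffleSum_add, sub_eq_iff_eq_add,
      ← unshuffleSum_add]
    refine (map_unshuffleSum (AddMonoidHom.mulLeft (psum K i ⊗ₜ[K] 1 + 1 ⊗ₜ[K] psum K i)) _ J).trans
      ?_
    congr 1
    funext x y
    exact h2 x y

end BinaryShuffle
end

/-! ### Existence of the quotient map: multiplicativity and kernel -/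

open scoped TensorProduct
noncomputable section
namespace BinaryShuffle

variable {K : Type*} [Field K]

/-! ### The projection of `WSym` onto `NSym` -/

/-- The linear map sending `M_π` to `V_{K(π)}`. -/
def stalacticMap (K : Type*) [Field K] : WSym K →ₗ[K] NSym K :=
  (Mbasis K).constr K fun w => Vlist K (content w.1)

@[simp] theorem stalacticMap_Mword (w : List ℕ) :
    stalacticMap K (Mword K w) = Vlist K (content w) := by
  obtain ⟨v, hv, h⟩ := exists_canon w
  have := (Mbasis K).constr_basis K (fun w => Vlist K (content w.1)) ⟨v, hv⟩
  rw [Mbasis_apply] at this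
  rw [Mword_congr h, h.content_eq]
  exact this

theorem stalacticMap_eq_sum (f : WSym K) :
    stalacticMap K f = ∑ w ∈ ((Mbasis K).repr f).support, f.1 w.1 • Vlist K (content w.1) := by
  rw [stalacticMap, Module.Basis.constr_apply, Finsupp.sum]
  exact Finset.sum_congr rfl fun w _ => by rw [Mbasis_repr]

theorem mem_support_Mbasis {f : WSym K} {w : {w : List ℕ // Canon w}} :
    w ∈ ((Mbasis K).repr f).support ↔ f.1 w.1 ≠ 0 := by
  rw [Finsupp.mem_support_iff, Mbasis_repr]

theorem Mword_nil : Mword K [] = 1 := by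
  refine WSym_ext fun w => ?_
  rw [Mword_apply]
  change _ = if w = [] then (1 : K) else 0
  by_cases h : w = []
  · subst h
    rw [if_pos (SamePattern.refl _), if_pos rfl]
  · rw [if_neg h, if_neg]
    intro h'
    exact h (List.length_eq_zero_iff.1 h'.1.symm)

theorem stalacticMap_one : stalacticMap K 1 = 1 := by
  rw [← Mword_nil, stalacticMap_Mword, content, List.dedup_nil, List.map_nil, Vlist]

/-! ### Multiplication by the power sums -/

theorem replicate_append_inj {i a b : ℕ} (hi : 0 < i) {u v : List ℕ}
    (h : List.replicate i a ++ u = List.replicate i b ++ v) : a = b ∧ u = v := by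
  obtain ⟨h1, h2⟩ := List.append_inj h (by simp)
  refine ⟨?_, h2⟩
  have := congrArg List.head? h1
  simpa [List.head?_replicate, hi.ne'] using this

/-- The left factor consists of the words $a^i$; in a product word the letter a is either new or one
of the letters already present, and exactly one of these cases matches a given word. -/
theorem powerSum_mul_Mword {i fresh : ℕ} (hi : 0 < i) {v : List ℕ} (hf : fresh ∉ v) :
    Mword K (List.replicate i 0) * Mword K v =
      ((fresh :: v.dedup).map fun a => Mword K (List.replicate i a ++ v)).sum := by
  refine WSym_ext fun w => ?_
  rw [Mword_mul_apply, ← evalWord_apply w (List.sum _), map_list_sum, List.map_map,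
    Mword_apply, Mword_apply]
  rw [List.length_replicate]
  have hnd : (fresh :: v.dedup).Nodup :=
    List.nodup_cons.2 ⟨by simpa using hf, v.nodup_dedup⟩
  have key : ∀ a ∈ fresh :: v.dedup, ∀ b ∈ fresh :: v.dedup,
      SamePattern (List.replicate i a ++ v) w → SamePattern (List.replicate i b ++ v) w →
        a = b := by
    intro a ha b hb h1 h2
    obtain ⟨s, hs⟩ := (h1.trans h2.symm).exists_perm
    rw [List.map_append, List.map_replicate] at hs
    obtain ⟨h3, h4⟩ := replicate_append_inj hi hs
    have h5 : ∀ x ∈ v, s x = x := List.map_inj_left.1 (h4.symm.trans (List.map_id v).symm)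
    rw [List.mem_cons, List.mem_dedup] at ha hb
    rcases ha with rfl | ha
    · rcases hb with rfl | hb
      · rfl
      · exact s.injective (h3.symm.trans (h5 b hb).symm)
    · exact (h5 a ha).symm.trans h3.symm
  by_cases h : SamePattern (List.replicate i 0) (w.take i) ∧ SamePattern v (w.drop i)
  · rw [if_pos h.1, if_pos h.2, mul_one]
    obtain ⟨s, hs⟩ := h.1.exists_perm
    obtain ⟨t, ht⟩ := h.2.exists_perm
    rw [List.map_replicate] at hs
    have hw : w = List.replicate i (s 0) ++ v.map t := by rw [← hs, ← ht, List.take_append_drop]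
    have hex : ∃ a ∈ fresh :: v.dedup, SamePattern (List.replicate i a ++ v) w := by
      -- The letter of the prefix, read back in the alphabet of v, decides which summand matches.
      by_cases hv : t.symm (s 0) ∈ v
      · refine ⟨t.symm (s 0), by simp [hv], ?_⟩
        have := samePattern_map (u := List.replicate i (t.symm (s 0)) ++ v) t.injective
        rwa [List.map_append, List.map_replicate, Equiv.apply_symm_apply, ← hw] at this
      · refine ⟨fresh, by simp, ?_⟩
        have := samePattern_map (u := List.replicate i fresh ++ v)
          ((Equiv.swap fresh (t.symm (s 0))).trans t).injective
        rw [List.map_append, List.map_replicate, Equiv.trans_apply, Equiv.swap_apply_left,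
          Equiv.apply_symm_apply] at this
        rw [hw]
        convert this using 2
        refine List.map_congr_left fun x hx => ?_
        rw [Equiv.trans_apply, Equiv.swap_apply_of_ne_of_ne]
        · rintro rfl; exact hf hx
        · rintro rfl; exact hv hx
    obtain ⟨a, ha, hw'⟩ := hex
    rw [← List.sum_toFinset _ hnd, Finset.sum_eq_single_of_mem a (List.mem_toFinset.2 ha)]
    · rw [Function.comp_apply, evalWord_apply, Mword_apply, if_pos hw']
    · intro b hb hba
      rw [Function.comp_apply, evalWord_apply, Mword_apply, if_neg]
      intro hw''
      exact hba (key b (List.mem_toFinset.1 hb) a ha hw'' hw')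
  · classical
    have h0 : (if SamePattern (List.replicate i 0) (w.take i) then (1 : K) else 0) *
        (if SamePattern v (w.drop i) then 1 else 0) = 0 := by
      by_cases h1 : SamePattern (List.replicate i 0) (w.take i)
      · rw [if_neg fun h2 => h ⟨h1, h2⟩, mul_zero]
      · rw [if_neg h1, zero_mul]
    rw [h0]
    refine (List.sum_eq_zero fun x hx => ?_).symm
    obtain ⟨a, -, rfl⟩ := List.mem_map.1 hx
    rw [Function.comp_apply, evalWord_apply, Mword_apply, if_neg]
    intro hw
    refine h ⟨?_, ?_⟩
    · have := hw.take i
      rw [List.take_left' (by simp)] at this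
      refine SamePattern.trans ?_ this
      have h3 := samePattern_map (u := List.replicate i 0) (Equiv.swap 0 a).injective
      rwa [List.map_replicate, Equiv.swap_apply_left] at h3
    · have := hw.drop i
      rwa [List.drop_left' (by simp)] at this

theorem map_merges (i : ℕ) (l : List ℕ) (hl : l.Nodup) (f : ℕ → ℕ) :
    l.map (fun a => l.map fun x => (if x = a then i else 0) + f x) = merges i (l.map f) := by
  induction l with
  | nil => rfl
  | cons b l ih =>
    obtain ⟨hb, hl'⟩ := List.nodup_cons.1 hl
    rw [List.map_cons, List.map_cons, List.map_cons, merges, ← ih hl', List.map_map, if_pos rfl]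
    congr 1
    · congr 1
      refine List.map_congr_left fun x hx => ?_
      rw [if_neg, zero_add]
      rintro rfl
      exact hb hx
    · refine List.map_congr_left fun a ha => ?_
      rw [List.map_cons, if_neg, zero_add, Function.comp_apply]
      rintro rfl
      exact hb ha

theorem content_replicate_append {i a : ℕ} (hi : 0 < i) {v : List ℕ} (ha : a ∈ v) :
    content (List.replicate i a ++ v) =
      v.dedup.map fun x => (if x = a then i else 0) + v.count x := by
  rw [content, dedup_append', dedup_replicate hi, List.filter_cons_of_neg (by simpa using ha),
    List.filter_nil, List.nil_append]
  refine List.map_congr_left fun x _ => ?_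
  rw [List.count_append, List.count_replicate]
  by_cases h : x = a
  · simp [h]
  · simp [h, Ne.symm h]

/-- The product was expanded so as to match the recursion of `Vlist`: the fresh letter ends before
all others and puts i in front of the content, while a letter of v has its multiplicity increased by
i. -/
theorem stalacticMap_powerSum_mul {i : ℕ} (hi : 0 < i) (g : WSym K) :
    stalacticMap K (Mword K (List.replicate i 0) * g) = psum K i * stalacticMap K g := by
  induction g using Mword_induction with
  | h v =>
    obtain ⟨fresh, hf⟩ := Infinite.exists_notMem_finset v.toFinset
    rw [List.mem_toFinset] at hf
    rw [powerSum_mul_Mword hi hf, map_list_sum, List.map_map, List.map_cons, List.sum_cons,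
      Function.comp_apply, stalacticMap_Mword, stalacticMap_Mword, content_fresh_append hi hf,
      psum_mul_Vlist]
    conv_rhs => rw [content]
    rw [← map_merges i _ v.nodup_dedup, List.map_map]
    congr 2
    refine List.map_congr_left fun a ha => ?_
    rw [Function.comp_apply, Function.comp_apply, stalacticMap_Mword,
      content_replicate_append hi (List.mem_dedup.1 ha)]
  | h0 => simp
  | hadd f g h1 h2 => rw [mul_add, map_add, map_add, h1, h2, mul_add]
  | hsmul r f h => rw [mul_smul_comm, map_smul, map_smul, h, mul_smul_comm]

/-! ### A section of the projection -/

/-- Lifts of the complete functions to `WSym`. -/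
def completeLift (K : Type*) [Field K] : ℕ → WSym K
  | 0 => 1
  | n + 1 => ((n + 1 : ℕ) : K)⁻¹ • ∑ i : Fin (n + 1),
      Mword K (List.replicate (i + 1) 0) * completeLift K (n - i)

theorem stalacticMap_completeLift_mul [CharZero K] (n : ℕ) (g : WSym K) :
    stalacticMap K (completeLift K n * g) = S K n * stalacticMap K g := by
  induction n using Nat.strong_induction_on with
  | _ n ih =>
    obtain _ | n := n
    · rw [completeLift, one_mul, S_zero, one_mul]
    · have hn : ((n + 1 : ℕ) : K) ≠ 0 := Nat.cast_ne_zero.2 (Nat.succ_ne_zero n)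
      have h := sum_psum_mul_S K (n + 1)
      rw [Finset.Nat.sum_antidiagonal_eq_sum_range_succ fun i j => psum K i * S K j,
        Finset.sum_range_succ', psum_zero, zero_mul, add_zero] at h
      rw [completeLift, smul_mul_assoc, map_smul, Finset.sum_mul, map_sum]
      have h2 : ∀ i : Fin (n + 1), stalacticMap K (Mword K (List.replicate (i + 1) 0) *
          completeLift K (n - i) * g) = psum K (i + 1) * S K (n - i) * stalacticMap K g := by
        intro i
        rw [mul_assoc, stalacticMap_powerSum_mul (Nat.succ_pos _), ih _ (by omega), mul_assoc]
      simp only [h2]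
      rw [← Finset.sum_mul, Fin.sum_univ_eq_sum_range (fun i => psum K (i + 1) * S K (n - i))]
      have h3 : ∑ i ∈ Finset.range (n + 1), psum K (i + 1) * S K (n - i) =
          ((n + 1 : ℕ) : K) • S K (n + 1) := by
        rw [← h]
        refine Finset.sum_congr rfl fun i _ => ?_
        rw [Nat.add_sub_add_right]
      rw [h3, smul_mul_assoc, smul_smul, inv_mul_cancel₀ hn, one_smul]

/-- The algebra map `NSym → WSym` which is a section of the projection. -/
def nsymLift (K : Type*) [Field K] : NSym K →ₐ[K] WSym K :=
  FreeAlgebra.lift K fun n : ℕ+ => completeLift K n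

/-- Checked on the generators $S_n$, which in characteristic 0 are polynomials in the power sums.
This is half of multiplicativity, and with `g = 1` it yields surjectivity. -/
theorem stalacticMap_nsymLift_mul [CharZero K] (x : NSym K) (g : WSym K) :
    stalacticMap K (nsymLift K x * g) = x * stalacticMap K g := by
  induction x using FreeAlgebra.induction generalizing g with
  | grade0 r =>
    rw [AlgHom.commutes, ← Algebra.smul_def, ← Algebra.smul_def, map_smul]
  | grade1 n =>
    rw [nsymLift, FreeAlgebra.lift_ι_apply, stalacticMap_completeLift_mul, S_coe]
  | mul x y hx hy => rw [map_mul (nsymLift K), mul_assoc, hx, hy, mul_assoc]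
  | add x y hx hy => rw [map_add, add_mul, map_add, hx, hy, add_mul]

theorem stalacticMap_nsymLift [CharZero K] (x : NSym K) : stalacticMap K (nsymLift K x) = x := by
  have := stalacticMap_nsymLift_mul x 1
  rwa [mul_one, stalacticMap_one, mul_one] at this

theorem stalacticMap_surjective [CharZero K] : Function.Surjective (stalacticMap K) :=
  fun x => ⟨_, stalacticMap_nsymLift x⟩

/-! ### The kernel of the projection -/

theorem span_Vlist [CharZero K] :
    ⊤ ≤ Submodule.span K (Set.range fun I : Σ n, Composition n => Vlist K I.2.blocks) := by
  intro x _
  obtain ⟨f, rfl⟩ := stalacticMap_surjective x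
  induction f using Mword_induction with
  | h w =>
    rw [stalacticMap_Mword]
    exact Submodule.subset_span ⟨⟨_, contentComp w⟩, rfl⟩
  | h0 => rw [map_zero]; exact Submodule.zero_mem _
  | hadd f g h1 h2 => rw [map_add]; exact Submodule.add_mem _ (h1 trivial) (h2 trivial)
  | hsmul r f h => rw [map_smul]; exact Submodule.smul_mem _ _ (h trivial)

/-- The elements `V_I` as a basis of `NSym`. -/
def Vlistbasis (K : Type*) [Field K] [CharZero K] :
    Module.Basis (Σ n, Composition n) K (NSym K) :=
  Module.Basis.mk (v := fun I => Vlist K I.2.blocks)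
    (linearIndependent_of_homogeneous (Sbasis K) _ (fun n I => by
      rw [← nsymDegree_eq]
      have := Vlist_mem_nsymDegree K I.blocks
      rwa [I.blocks_sum] at this) span_Vlist) span_Vlist

theorem Vlistbasis_apply [CharZero K] (I : Σ n, Composition n) :
    Vlistbasis K I = Vlist K I.2.blocks := by
  rw [Vlistbasis, Module.Basis.mk_apply]

/-- The span of the differences of basis elements with the same multiplicities. -/
def contentDiffs (K : Type*) [Field K] : Submodule K (WSym K) :=
  Submodule.span K {f | ∃ u v, content u = content v ∧ f = Mword K u - Mword K v}

/-- As the $V_I$ form a basis, a linear section r may send $V_I$ to the interval word of content I.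
Then g minus r of its image is a combination of differences for every g, and on the kernel it equals
g. -/
theorem mem_contentDiffs_of_stalacticMap_eq_zero [CharZero K] {f : WSym K}
    (hf : stalacticMap K f = 0) : f ∈ contentDiffs K := by
  let r : NSym K →ₗ[K] WSym K :=
    (Vlistbasis K).constr K fun I => Mword K (intervalWord 0 I.2.blocks)
  have hr : ∀ g, g - r (stalacticMap K g) ∈ contentDiffs K := by
    intro g
    induction g using Mword_induction with
    | h w =>
      have h1 := (Vlistbasis K).constr_basis K (fun I => Mword K (intervalWord 0 I.2.blocks))
        ⟨_, contentComp w⟩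
      rw [Vlistbasis_apply] at h1
      have h2 : r (stalacticMap K (Mword K w)) = Mword K (intervalWord 0 (content w)) := by
        rw [stalacticMap_Mword]
        exact h1
      rw [h2]
      exact Submodule.subset_span ⟨_, _,
        (content_intervalWord 0 fun i hi => pos_of_mem_content hi).symm, rfl⟩
    | h0 => simp
    | hadd f g h1 h2 =>
      have := Submodule.add_mem _ h1 h2
      rwa [sub_add_sub_comm, ← map_add, ← map_add] at this
    | hsmul a f h =>
      have := Submodule.smul_mem _ a h
      rwa [smul_sub, ← map_smul, ← map_smul] at this
  have := hr f
  rwa [hf, map_zero, sub_zero] at this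

/-- Replacement of the prefix with the pattern of `u` by a prefix with the pattern of `u'`. -/
def replacePrefix (u u' w : List ℕ) : List ℕ :=
  open Classical in
  if h : SamePattern u (w.take u.length) then
    u'.map h.exists_perm.choose ++ w.drop u.length else w

theorem replacePrefix_eq {u u' : List ℕ} (h : u.Perm u') (s : Equiv.Perm ℕ) (y : List ℕ) :
    replacePrefix u u' (u.map s ++ y) = u'.map s ++ y := by
  have h1 : (u.map s ++ y).take u.length = u.map s := List.take_left' (by simp)
  have h2 : (u.map s ++ y).drop u.length = y := List.drop_left' (by simp)
  have h3 : SamePattern u ((u.map s ++ y).take u.length) := by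
    rw [h1]
    exact samePattern_map s.injective
  rw [replacePrefix, dif_pos h3, h2]
  congr 1
  -- The chosen permutation need not be s, but it agrees with s on the letters of u, which are those
  -- of u'.
  have h4 := h1.symm.trans h3.exists_perm.choose_spec
  exact (List.map_congr_left fun a ha => List.map_inj_left.1 h4 a (h.mem_iff.2 ha)).symm

theorem Mword_mul_ne_zero {u : List ℕ} {g : WSym K} {w : List ℕ}
    (h : (Mword K u * g).1 w ≠ 0) : ∃ (s : Equiv.Perm ℕ) (y : List ℕ), w = u.map s ++ y := by
  rw [Mword_mul_apply] at h
  have h1 := left_ne_zero_of_mul h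
  rw [Mword_apply] at h1
  have h2 : SamePattern u (w.take u.length) := by
    by_contra h2
    exact h1 (if_neg h2)
  obtain ⟨s, hs⟩ := h2.exists_perm
  exact ⟨s, w.drop u.length, by rw [← hs, List.take_append_drop]⟩

theorem Mword_mul_map_append (u : List ℕ) (g : WSym K) (s : Equiv.Perm ℕ) (y : List ℕ) :
    (Mword K u * g).1 (u.map s ++ y) = g.1 y := by
  rw [Mword_mul_apply, List.take_left' (by simp), List.drop_left' (by simp), Mword_apply,
    if_pos (samePattern_map s.injective), one_mul]

theorem dedup_map_append {u u' : List ℕ} (h : u.dedup = u'.dedup) (s : Equiv.Perm ℕ)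
    (y : List ℕ) : (u.map s ++ y).dedup = (u'.map s ++ y).dedup := by
  rw [dedup_append', dedup_append', dedup_map_perm, dedup_map_perm, h]

theorem content_map_append {u u' : List ℕ} (h : u.dedup = u'.dedup) (hp : u.Perm u')
    (s : Equiv.Perm ℕ) (y : List ℕ) : content (u.map s ++ y) = content (u'.map s ++ y) := by
  rw [content, content, dedup_map_append h]
  exact List.map_congr_left fun a _ => ((hp.map s).append_right y).count_eq a

/-- Exchanging the prefixes is a bijection between the canonical words of the two products. It
preserves coefficients, which depend only on the suffix, and content, since multiplicities and the
order of last occurrences are unchanged. -/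
theorem stalacticMap_Mword_mul_of_perm {u u' : List ℕ} (h : u.dedup = u'.dedup) (hp : u.Perm u')
    (g : WSym K) : stalacticMap K (Mword K u * g) = stalacticMap K (Mword K u' * g) := by
  have hcanon : ∀ {u u' : List ℕ}, u.dedup = u'.dedup → u.Perm u' →
      ∀ w : {w : List ℕ // Canon w}, w ∈ ((Mbasis K).repr (Mword K u * g)).support →
        Canon (replacePrefix u u' w.1) := by
    intro u u' h hp w hw
    obtain ⟨s, y, e⟩ := Mword_mul_ne_zero (mem_support_Mbasis.1 hw)
    have := w.2
    rw [Canon, e, dedup_map_append h] at this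
    rw [e, replacePrefix_eq hp]
    exact this
  have hmem : ∀ {u u' : List ℕ} (h : u.dedup = u'.dedup) (hp : u.Perm u')
      (w : {w : List ℕ // Canon w}) (hw : w ∈ ((Mbasis K).repr (Mword K u * g)).support),
        (⟨replacePrefix u u' w.1, hcanon h hp w hw⟩ : {w : List ℕ // Canon w}) ∈
          ((Mbasis K).repr (Mword K u' * g)).support := by
    intro u u' h hp w hw
    rw [mem_support_Mbasis] at hw ⊢
    obtain ⟨s, y, e⟩ := Mword_mul_ne_zero hw
    rw [e, Mword_mul_map_append] at hw
    simp only
    rwa [e, replacePrefix_eq hp, Mword_mul_map_append]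
  have hinv : ∀ {u u' : List ℕ} (hp : u.Perm u')
      (w : {w : List ℕ // Canon w}) (hw : w ∈ ((Mbasis K).repr (Mword K u * g)).support),
        replacePrefix u' u (replacePrefix u u' w.1) = w.1 := by
    intro u u' hp w hw
    obtain ⟨s, y, e⟩ := Mword_mul_ne_zero (mem_support_Mbasis.1 hw)
    rw [e, replacePrefix_eq hp, replacePrefix_eq hp.symm]
  rw [stalacticMap_eq_sum, stalacticMap_eq_sum]
  refine Finset.sum_bij' (fun w hw => ⟨replacePrefix u u' w.1, hcanon h hp w hw⟩)
    (fun w hw => ⟨replacePrefix u' u w.1, hcanon h.symm hp.symm w hw⟩) (hmem h hp)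
    (hmem h.symm hp.symm) (fun w hw => Subtype.ext (hinv hp w hw))
    (fun w hw => Subtype.ext (hinv hp.symm w hw)) fun w hw => ?_
  obtain ⟨s, y, e⟩ := Mword_mul_ne_zero (mem_support_Mbasis.1 hw)
  simp only
  rw [e, replacePrefix_eq hp, Mword_mul_map_append, Mword_mul_map_append,
    content_map_append h hp]

/-- After relabelling u' so that its letters end in the same order as those of u, equal contents
mean equal multiplicities of each letter. -/
theorem stalacticMap_Mword_mul_congr {u u' : List ℕ} (h : content u = content u') (g : WSym K) :
    stalacticMap K (Mword K u * g) = stalacticMap K (Mword K u' * g) := by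
  have hl : u'.dedup.length = u.dedup.length := by
    have := congrArg List.length h
    rw [content, content, List.length_map, List.length_map] at this
    exact this.symm
  obtain ⟨s, hs⟩ := (samePattern_of_nodup u'.nodup_dedup u.nodup_dedup hl).exists_perm
  have hd : u.dedup = (u'.map s).dedup := by rw [dedup_map_perm, hs]
  rw [Mword_congr (K := K) (samePattern_map (u := u') s.injective)]
  refine stalacticMap_Mword_mul_of_perm hd ?_ g
  have hc : content u = content (u'.map s) :=
    h.trans (samePattern_map s.injective).content_eq
  rw [content, content, ← hd] at hc
  rw [List.perm_iff_count]
  intro a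
  by_cases ha : a ∈ u.dedup
  · exact List.map_inj_left.1 hc a ha
  · have ha' := ha
    rw [hd, List.mem_dedup] at ha'
    rw [List.mem_dedup] at ha
    rw [List.count_eq_zero_of_not_mem ha, List.count_eq_zero_of_not_mem ha']

theorem stalacticMap_mul_eq_zero [CharZero K] {f : WSym K} (hf : stalacticMap K f = 0)
    (g : WSym K) : stalacticMap K (f * g) = 0 := by
  have h := mem_contentDiffs_of_stalacticMap_eq_zero hf
  clear hf
  induction h using Submodule.span_induction with
  | mem f hf =>
    obtain ⟨u, v, huv, rfl⟩ := hf
    rw [sub_mul, map_sub, stalacticMap_Mword_mul_congr huv, sub_self]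
  | zero => rw [zero_mul, map_zero]
  | add f f' _ _ h1 h2 => rw [add_mul, map_add, h1, h2, add_zero]
  | smul r f _ h => rw [smul_mul_assoc, map_smul, h, smul_zero]

/-- Modulo the kernel, which is a right ideal, f may be replaced by the lift of its image, for which
left multiplication is already understood. -/
theorem stalacticMap_mul [CharZero K] (f g : WSym K) :
    stalacticMap K (f * g) = stalacticMap K f * stalacticMap K g := by
  have h := stalacticMap_mul_eq_zero (f := f - nsymLift K (stalacticMap K f))
    (by rw [map_sub, stalacticMap_nsymLift, sub_self]) g
  rw [sub_mul, map_sub, stalacticMap_nsymLift_mul, sub_eq_zero] at h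
  exact h

/-- The projection `WSym → NSym` as an algebra map. -/
def stalacticHom (K : Type*) [Field K] [CharZero K] : WSym K →ₐ[K] NSym K :=
  AlgHom.ofLinearMap (stalacticMap K) stalacticMap_one stalacticMap_mul

theorem stalacticHom_apply [CharZero K] (f : WSym K) : stalacticHom K f = stalacticMap K f := rfl

theorem ker_stalacticHom [CharZero K] : TwoSidedIdeal.ker (stalacticHom K) = TwoSidedIdeal.span
    {x : WSym K | ∃ (n : ℕ) (π π' : SetPartition n),
      sizeComp π = sizeComp π' ∧ x = M K π - M K π'} := by
  apply le_antisymm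
  · intro f hf
    rw [TwoSidedIdeal.mem_ker, stalacticHom_apply] at hf
    have h := mem_contentDiffs_of_stalacticMap_eq_zero hf
    clear hf
    induction h using Submodule.span_induction with
    | mem f hf =>
      obtain ⟨u, v, huv, rfl⟩ := hf
      have hl : v.length = u.length := by rw [← sum_content, ← sum_content, huv]
      obtain ⟨π, h1, h2⟩ := exists_setPartition_of_length (K := K) (n := u.length) (w := u) rfl
      obtain ⟨π', h1', h2'⟩ := exists_setPartition_of_length (K := K) hl
      exact TwoSidedIdeal.subset_span ⟨_, π, π', by rw [h2, h2', huv], by rw [h1, h1']⟩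
    | zero => exact TwoSidedIdeal.zero_mem _
    | add f f' _ _ h1 h2 => exact TwoSidedIdeal.add_mem _ h1 h2
    | smul r f _ h =>
      rw [Algebra.smul_def]
      exact TwoSidedIdeal.mul_mem_left _ _ _ h
  · rw [TwoSidedIdeal.span_le]
    rintro _ ⟨n, π, π', h, rfl⟩
    rw [SetLike.mem_coe, TwoSidedIdeal.mem_ker, stalacticHom_apply, M_eq_Mword_wordOf,
      M_eq_Mword_wordOf, map_sub, stalacticMap_Mword, stalacticMap_Mword,
      ← sizeComp_eq_content_wordOf, ← sizeComp_eq_content_wordOf, h, sub_self]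

end BinaryShuffle
end

/-! ### Existence of the quotient map: compatibility with the coproducts -/

open scoped TensorProduct
noncomputable section
namespace BinaryShuffle

variable {K : Type*} [Field K]

/-! ### The coproduct of `M_π` -/

theorem cons_mem_shuffle_left {α : Type*} (a : α) {u v w : List α} (h : w ∈ shuffle u v) :
    a :: w ∈ shuffle (a :: u) v := by
  obtain _ | ⟨b, v⟩ := v
  · obtain _ | ⟨c, u⟩ := u <;> simp_all [shuffle]
  · rw [shuffle]
    exact List.mem_append_left _ (List.mem_map_of_mem h)

theorem cons_mem_shuffle_right {α : Type*} (a : α) {u v w : List α} (h : w ∈ shuffle u v) :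
    a :: w ∈ shuffle u (a :: v) := by
  obtain _ | ⟨b, u⟩ := u
  · simp_all [shuffle]
  · rw [shuffle]
    exact List.mem_append_right _ (List.mem_map_of_mem h)

theorem mem_shuffle_filter {α : Type*} (q : α → Bool) (w : List α) :
    w ∈ shuffle (w.filter q) (w.filter fun a => !q a) := by
  induction w with
  | nil => simp [shuffle]
  | cons a w ih =>
    cases h : q a
    · rw [List.filter_cons_of_neg (by simp [h]), List.filter_cons_of_pos (by simp [h])]
      exact cons_mem_shuffle_right a ih
    · rw [List.filter_cons_of_pos h, List.filter_cons_of_neg (by simp [h])]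
      exact cons_mem_shuffle_left a ih

theorem filter_of_mem_shuffle {α : Type*} (q : α → Bool) (u v : List α) (hu : ∀ a ∈ u, q a = true)
    (hv : ∀ a ∈ v, q a = false) {w : List α} (hw : w ∈ shuffle u v) :
    w.filter q = u ∧ w.filter (fun a => !q a) = v := by
  induction u, v using shuffle.induct generalizing w with
  | case1 v =>
    simp only [shuffle, List.mem_singleton] at hw
    subst hw
    exact ⟨List.filter_eq_nil_iff.2 fun a ha => by simp [hv a ha],
      List.filter_eq_self.2 fun a ha => by simp [hv a ha]⟩
  | case2 a u =>
    simp only [shuffle, List.mem_singleton] at hw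
    subst hw
    exact ⟨List.filter_eq_self.2 hu, List.filter_eq_nil_iff.2 fun a ha => by simp [hu a ha]⟩
  | case3 a u b v h1 h2 =>
    simp only [shuffle, List.mem_append, List.mem_map] at hw
    have ha := hu a (by simp)
    have hb := hv b (by simp)
    rcases hw with ⟨x, hx, rfl⟩ | ⟨x, hx, rfl⟩
    · obtain ⟨e1, e2⟩ := h1 (fun c hc => hu c (by simp [hc])) hv hx
      rw [List.filter_cons_of_pos ha, List.filter_cons_of_neg (by simp [ha]), e1, e2]
      exact ⟨rfl, rfl⟩
    · obtain ⟨e1, e2⟩ := h2 hu (fun c hc => hv c (by simp [hc])) hx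
      rw [List.filter_cons_of_neg (by simp [hb]), List.filter_cons_of_pos (by simp [hb]), e1, e2]
      exact ⟨rfl, rfl⟩

theorem nodup_shuffle {α : Type*} (u v : List α) (h : ∀ a ∈ u, a ∉ v) : (shuffle u v).Nodup := by
  induction u, v using shuffle.induct with
  | case1 v => simp [shuffle]
  | case2 a u => simp [shuffle]
  | case3 a u b v h1 h2 =>
    rw [shuffle]
    refine List.nodup_append.2 ⟨(h1 fun c hc => h c (by simp [hc])).map List.cons_injective,
      (h2 fun c hc hc' => h c hc (by simp [hc'])).map List.cons_injective, ?_⟩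
    rintro x hx y hy rfl
    obtain ⟨x', -, rfl⟩ := List.mem_map.1 hx
    obtain ⟨y', -, hy⟩ := List.mem_map.1 hy
    rw [List.cons.injEq] at hy
    exact h a (by simp) (by simp [hy.1])

theorem filter_map_of_eqOn {w : List ℕ} {f : ℕ → ℕ} {q r : ℕ → Bool}
    (h : ∀ a ∈ w, q (f a) = r a) : (w.map f).filter q = (w.filter r).map f := by
  rw [List.filter_map]
  congr 1
  exact List.filter_congr fun a ha => h a ha

/-- The splittings of the letters of `w` for which the two subwords have the patterns of `u` and
`v` correspond to the words with the pattern of `w` among the shuffles of disjoint copies of `u`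
and `v`. -/
theorem card_patterns_shuffle (w u v : List ℕ) :
    open Classical in
    (((shuffle (u.map fun x => 2 * x) (v.map fun x => 2 * x + 1)).toFinset.filter
      fun x => SamePattern w x).card =
    (w.toFinset.powerset.filter fun s => SamePattern (w.filter (· ∈ s)) u ∧
      SamePattern (w.filter (fun a => !decide (a ∈ s))) v).card) := by
  classical
  have hu : ∀ a ∈ u.map (fun x => 2 * x), decide (Even a) = true := by
    intro a ha
    obtain ⟨x, -, rfl⟩ := List.mem_map.1 ha
    simp
  have hv : ∀ a ∈ v.map (fun x => 2 * x + 1), decide (Even a) = false := by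
    intro a ha
    obtain ⟨x, -, rfl⟩ := List.mem_map.1 ha
    simp
  have hmap : ∀ s : Finset ℕ, SamePattern (w.filter (· ∈ s)) u →
      SamePattern (w.filter (fun a => !decide (a ∈ s))) v →
      ∃ f : ℕ → ℕ, Function.Injective f ∧ (∀ a, Even (f a) ↔ a ∈ s) ∧
        (w.filter (· ∈ s)).map f = u.map (fun x => 2 * x) ∧
        (w.filter (fun a => !decide (a ∈ s))).map f = v.map (fun x => 2 * x + 1) := by
    intro s h1 h2
    obtain ⟨s1, rfl⟩ := h1.exists_perm
    obtain ⟨s2, rfl⟩ := h2.exists_perm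
    -- The two relabellings are glued into one injection, with parity recording the side of each
    -- letter.
    refine ⟨fun a => if a ∈ s then 2 * s1 a else 2 * s2 a + 1, ?_, ?_, ?_, ?_⟩
    · intro a b hab
      simp only at hab
      split_ifs at hab
      · exact s1.injective (by omega)
      · omega
      · omega
      · exact s2.injective (by omega)
    · intro a
      beta_reduce
      split_ifs with h
      · simp [h]
      · simp [h]
    · rw [List.map_map]
      refine List.map_congr_left fun a ha => ?_
      have := (List.mem_filter.1 ha).2
      simp only [decide_eq_true_eq] at this
      simp [this]
    · rw [List.map_map]
      refine List.map_congr_left fun a ha => ?_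
      have := (List.mem_filter.1 ha).2
      simp only [Bool.not_eq_true', decide_eq_false_iff_not] at this
      simp [this]
  choose! f hf using hmap
  have hf' := fun (s : Finset ℕ) (hs : s ∈ w.toFinset.powerset.filter fun s =>
      SamePattern (w.filter (· ∈ s)) u ∧
        SamePattern (w.filter (fun a => !decide (a ∈ s))) v) =>
    hf s (Finset.mem_filter.1 hs).2.1 (Finset.mem_filter.1 hs).2.2
  symm
  refine Finset.card_bij (fun s _ => w.map (f s)) ?_ ?_ ?_
  · intro s hs
    obtain ⟨f1, f2, f3, f4⟩ := hf' s hs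
    refine Finset.mem_filter.2 ⟨List.mem_toFinset.2 ?_, samePattern_map f1⟩
    have := mem_shuffle_filter (fun a => decide (Even a)) (w.map (f s))
    rwa [filter_map_of_eqOn (r := fun a => decide (a ∈ s)) fun a _ => by simp [f2],
      filter_map_of_eqOn (r := fun a => !decide (a ∈ s)) fun a _ => by simp [f2], f3, f4] at this
  · intro s hs s' hs' he
    obtain ⟨-, f2, -, -⟩ := hf' s hs
    obtain ⟨-, f2', -, -⟩ := hf' s' hs'
    have hsub := Finset.mem_powerset.1 (Finset.mem_filter.1 hs).1
    have hsub' := Finset.mem_powerset.1 (Finset.mem_filter.1 hs').1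
    have hff : ∀ a ∈ w, f s a = f s' a := List.map_inj_left.1 he
    ext a
    constructor
    · intro ha
      rw [← f2', ← hff a (List.mem_toFinset.1 (hsub ha)), f2]
      exact ha
    · intro ha
      rw [← f2, hff a (List.mem_toFinset.1 (hsub' ha)), f2']
      exact ha
  · intro x hx
    obtain ⟨hx1, hx2⟩ := Finset.mem_filter.1 hx
    rw [List.mem_toFinset] at hx1
    obtain ⟨t, rfl⟩ := hx2.exists_perm
    obtain ⟨e1, e2⟩ := filter_of_mem_shuffle (fun a => decide (Even a)) _ _ hu hv hx1
    -- Conversely, the splitting is read off from the letters which the relabelling sends to even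
    -- numbers.
    let s := w.toFinset.filter fun a => Even (t a)
    have hs : ∀ a ∈ w, decide (Even (t a)) = decide (a ∈ s) := by
      intro a ha
      simp [s, ha]
    rw [filter_map_of_eqOn (q := fun a => decide (Even a)) hs] at e1
    rw [filter_map_of_eqOn (q := fun a => !decide (Even a)) (r := fun a => !decide (a ∈ s))
      fun a ha => by rw [hs a ha]] at e2
    have p1 : SamePattern (w.filter (· ∈ s)) u :=
      (samePattern_map t.injective).trans (e1 ▸ (samePattern_map two_mul_injective).symm)
    have p2 : SamePattern (w.filter (fun a => !decide (a ∈ s))) v :=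
      (samePattern_map t.injective).trans (e2 ▸ (samePattern_map two_mul_add_one_injective).symm)
    have hmem : s ∈ w.toFinset.powerset.filter fun s => SamePattern (w.filter (· ∈ s)) u ∧
        SamePattern (w.filter (fun a => !decide (a ∈ s))) v :=
      Finset.mem_filter.2 ⟨Finset.mem_powerset.2 (Finset.filter_subset _ _), p1, p2⟩
    refine ⟨s, hmem, ?_⟩
    obtain ⟨-, -, f3, f4⟩ := hf s p1 p2
    refine List.map_congr_left fun a ha => ?_
    by_cases has : a ∈ s
    · exact List.map_inj_left.1 (f3.trans e1.symm) a (List.mem_filter.2 ⟨ha, by simpa using has⟩)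
    · exact List.map_inj_left.1 (f4.trans e2.symm) a (List.mem_filter.2 ⟨ha, by simpa using has⟩)

/-- Each letter is put wholly into one of the two alphabets, so the terms are indexed by sets of
letters. The count `card_patterns_shuffle` compares coefficients. -/
theorem isCoproduct_Mword (w : List ℕ) :
    IsCoproduct (Mword K w) (∑ s ∈ w.toFinset.powerset,
      Mword K (w.filter (· ∈ s)) ⊗ₜ[K] Mword K (w.filter (fun a => !decide (a ∈ s)))) :=
  fun u v => by
    classical
    have hnd : (shuffle (u.map fun x => 2 * x) (v.map fun x => 2 * x + 1)).Nodup := by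
      refine nodup_shuffle _ _ fun a ha ha' => ?_
      obtain ⟨x, -, rfl⟩ := List.mem_map.1 ha
      obtain ⟨y, -, hy⟩ := List.mem_map.1 ha'
      omega
    have h1 : doubling (Mword K w).1 u v =
        ∑ x ∈ (shuffle (u.map fun x => 2 * x) (v.map fun x => 2 * x + 1)).toFinset,
          if SamePattern w x then (1 : K) else 0 := by
      rw [List.sum_toFinset _ hnd]
      congr 1
    rw [h1, Finset.sum_boole, card_patterns_shuffle, ← Finset.sum_boole, map_sum]
    refine Finset.sum_congr rfl fun s _ => ?_
    rw [tensorCoeff_tmul, Mword_apply, Mword_apply]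
    by_cases h1 : SamePattern (w.filter (· ∈ s)) u <;>
      by_cases h2 : SamePattern (w.filter (fun a => !decide (a ∈ s))) v <;> simp [h1, h2]

theorem content_filter (w : List ℕ) (q : ℕ → Bool) :
    content (w.filter q) = (w.dedup.filter q).map w.count := by
  have h : (w.filter q).dedup = w.dedup.filter q := by
    induction w with
    | nil => rfl
    | cons a w ih =>
      by_cases ha : a ∈ w <;> cases hq : q a
      · rw [List.filter_cons_of_neg (by simp [hq]), List.dedup_cons_of_mem ha, ih]
      · rw [List.filter_cons_of_pos hq, List.dedup_cons_of_mem ha,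
          List.dedup_cons_of_mem (List.mem_filter.2 ⟨ha, hq⟩), ih]
      · rw [List.filter_cons_of_neg (by simp [hq]), List.dedup_cons_of_notMem ha,
          List.filter_cons_of_neg (by simp [hq]), ih]
      · rw [List.filter_cons_of_pos hq, List.dedup_cons_of_notMem ha,
          List.filter_cons_of_pos hq,
          List.dedup_cons_of_notMem fun h => ha (List.mem_filter.1 h).1, ih]
  rw [content, h]
  exact List.map_congr_left fun a ha => List.count_filter (List.mem_filter.1 ha).2

/-- For distinct letters a splitting into subwords amounts to a subset. The map c is applied only
afterwards because multiplicities may repeat. -/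
theorem sum_powerset_eq_unshuffleSum {E : Type*} [AddCommMonoid E] (l : List ℕ) (hl : l.Nodup)
    (c : ℕ → ℕ) (f : List ℕ → List ℕ → E) :
    ∑ s ∈ l.toFinset.powerset, f ((l.filter (· ∈ s)).map c)
      ((l.filter (fun a => !decide (a ∈ s))).map c) = unshuffleSum f (l.map c) := by
  induction l generalizing f with
  | nil => simp [unshuffleSum_nil]
  | cons a l ih =>
    obtain ⟨ha, hl'⟩ := List.nodup_cons.1 hl
    rw [List.toFinset_cons, Finset.sum_powerset_insert (by simpa using ha), List.map_cons,
      unshuffleSum_cons, ← ih hl', ← ih hl', add_comm]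
    congr 1
    · refine Finset.sum_congr rfl fun s hs => ?_
      have h1 : l.filter (· ∈ insert a s) = l.filter (· ∈ s) := by
        refine List.filter_congr fun b hb => ?_
        have : b ≠ a := by rintro rfl; exact ha hb
        simp [this]
      have h2 : (l.filter fun b => !decide (b ∈ insert a s)) =
          l.filter fun b => !decide (b ∈ s) := by
        refine List.filter_congr fun b hb => ?_
        have : b ≠ a := by rintro rfl; exact ha hb
        simp [this]
      rw [List.filter_cons_of_pos (by simp), List.filter_cons_of_neg (by simp), h1, h2,
        List.map_cons]
    · refine Finset.sum_congr rfl fun s hs => ?_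
      have has : a ∉ s := fun h => ha (by simpa using Finset.mem_powerset.1 hs h)
      rw [List.filter_cons_of_neg (by simpa using has), List.filter_cons_of_pos (by simpa using has),
        List.map_cons]

variable [CharZero K]

theorem exists_coproduct_stalacticHom (f : WSym K) : ∃ t : WSym K ⊗[K] WSym K, IsCoproduct f t ∧
    nsymCoproduct K (stalacticHom K f) =
      TensorProduct.map (stalacticHom K).toLinearMap (stalacticHom K).toLinearMap t := by
  induction f using Mword_induction with
  | h w =>
    refine ⟨_, isCoproduct_Mword w, ?_⟩
    rw [stalacticHom_apply, stalacticMap_Mword, nsymCoproduct_Vlist, map_sum, content,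
      ← sum_powerset_eq_unshuffleSum _ w.nodup_dedup]
    refine Finset.sum_congr (by congr 1; ext; simp) fun s _ => ?_
    rw [TensorProduct.map_tmul, AlgHom.toLinearMap_apply, AlgHom.toLinearMap_apply,
      stalacticHom_apply, stalacticHom_apply, stalacticMap_Mword, stalacticMap_Mword,
      content_filter, content_filter]
  | h0 => exact ⟨0, IsCoproduct.zero, by simp⟩
  | hadd f g h1 h2 =>
    obtain ⟨s, hs, hs'⟩ := h1
    obtain ⟨t, ht, ht'⟩ := h2
    exact ⟨s + t, hs.add ht, by rw [map_add, map_add, map_add, hs', ht']⟩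
  | hsmul r f h =>
    obtain ⟨s, hs, hs'⟩ := h
    exact ⟨r • s, hs.smul r, by rw [map_smul, map_smul, map_smul, hs']⟩

theorem isStalacticQuotient_stalacticHom : IsStalacticQuotient (stalacticHom K) where
  surjective := stalacticMap_surjective
  ker_eq := ker_stalacticHom
  map_degree n π := by
    rw [stalacticHom_apply, M_eq_Mword_wordOf, stalacticMap_Mword]
    have := Vlist_mem_nsymDegree K (content (wordOf π))
    rwa [sum_content, length_wordOf] at this
  map_coproduct := exists_coproduct_stalacticHom

end BinaryShuffle
end

theorem mainTheorem2 (K : Type*) [Field K] [CharZero K] :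
    (∃ p : WSym K →ₐ[K] NSym K, IsStalacticQuotient p) ∧
    ∀ p : WSym K →ₐ[K] NSym K, IsStalacticQuotient p →
      ∃ V : Module.Basis (Σ n, Composition n) K (NSym K),
        (∀ (n : ℕ) (I : Composition n) (π : SetPartition n),
          sizeComp π = I.blocks → V ⟨n, I⟩ = p (M K π)) ∧
      ∃ X : Module.Basis (Σ n, Composition n) K (NSym K),
        (∀ (n : ℕ) (J : Composition n),
          X ⟨n, J⟩ = ∑ I : Composition n, (c I J : K) • V ⟨n, I⟩) ∧
      ∃ Z : Module.Basis (Σ n, Composition n) K (QSym K),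
        (∀ I J, pairing (Z I : MvPowerSeries ℕ K) (X J) = if I = J then 1 else 0) ∧
        ∀ (n m : ℕ) (I : Composition n) (J : Composition m),
          (Z ⟨n, I⟩ : MvPowerSeries ℕ K) * (Z ⟨m, J⟩ : MvPowerSeries ℕ K) =
            ∑ K' : Composition (n + m),
              (shuffleCoeff (binWord K'.blocks) (binWord I.blocks) (binWord J.blocks) : K) •
                (Z ⟨n + m, K'⟩ : MvPowerSeries ℕ K) := by
  refine ⟨⟨stalacticHom K, isStalacticQuotient_stalacticHom⟩, fun p hp => ?_⟩
  refine ⟨hp.Vbasis, fun n I π h => hp.Vbasis_eq_M I π h, hp.Xbasis, fun n J => ?_,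
    hp.Zbasis, fun I J => ?_, fun n m I J => ?_⟩
  · rw [hp.Xbasis_apply, hp.lastSum_eq]
  · rw [hp.Zbasis_apply, hp.pairing_dualFamily_Xbasis]
  · simp only [hp.Zbasis_apply]
    exact hp.dualFamily_mul n m I J
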